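/- Setting. Let $X$ be a measurable space, $D$ a probability measure on $X$, $\mathcal P$ a set of functions $X\to\{0,1\}$, and $\mathrm{dist}_D(f,\mathcal P)=\inf_{g\in\mathcal P}\Pr_{x\sim D}[f(x)\ne g(x)]$. A distribution $\pi$ over boolean functions is the law of a jointly measurable random function $f_\omega(x)$, $\omega$ drawn from a probability space. For $S\in X^q$ and $y\in\{0,1\}^q$ put $\pi_S(y)=\Pr_{f\sim\pi}[f(S)=y]$, and let $d_S(\pi,\pi')=\frac12\sum_{y}|\pi_S(y)-\pi'_S(y)|$. For $\varepsilon>0$ and $\delta\geq 0$ let $\Pi_0$ be the set of distributions over functions in $\mathcal P$, and let $\Pi_{\varepsilon,\delta}$ be the set of distributions $\pi'$ with $\Pr_{f\sim\pi'}[\mathrm{dist}_D(f,\mathcal P)<\varepsilon]\le\delta$. * The passive testing dimension $d_{passive}(\mathcal P,D)$ (at $\varepsilon,\delta$) is the largest $q\in\mathbb N$ for which there exist $\pi\in\Pi_0$ and $\pi'\in\Pi_{\varepsilon,\delta}$ with $\Pr_{S\sim D^q}\big(d_S(\pi,\pi')>1/4\big)\le 1/4$. * For $U\in X^u$ let $\mathrm{Fair}(\pi,\pi',U)$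 be the distribution of $(y,\ell)\in\{0,1\}^u\times\{0,1\}$ obtained by drawing $y\sim\pi_U$, $\ell=1$ with probability $1/2$ and $y\sim\pi'_U$, $\ell=0$ with probability $1/2$. Let $\mathrm{DT}_q$ be the class of boolean functions on $\{0,1\}^u$ computed by decision trees of depth at most $q$, and let $\mathrm{err}^*(\mathrm{DT}_q,P)=\min_{h\in \mathrm{DT}_q}\Pr_{(y,\ell)\sim P}[h(y)\ne\ell]$. The active testing dimension $d_{active}(\mathcal P,D,u)$ (at $\varepsilon,\delta$) is the largest $q\in\mathbb N$ for which there exist $\pi\in\Pi_0$ and $\pi'\in\Pi_{\varepsilon,\delta}$ with $\Pr_{U\sim D^u}\big(\mathrm{err}^*(\mathrm{DT}_q,\mathrm{Fair}(\pi,\pi',U))<1/4\big)\le 1/4$. (Both dimensions are $+\infty$ if there are arbitrarily large such $q$.) Theorem. Let $\mathcal P_n$ be the class of linear threshold functions $x\mapsto\mathrm{sgn}(w_1x_1+\dots+w_nx_n-\theta)$ on $\mathbb R^n$, with $w\in\mathbb R^n$, $\theta\in\mathbb R$, where $\mathrm{sgn}(t)=1$ if $t\ge0$ and $0$ otherwise,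 and let $D_n$ be the standard Gaussian distribution on $\mathbb R^n$. 1. There is a constant $c>0$ such that for every $\varepsilon\in(0,1/2)$ there is a sequence $\delta_n\to0$ such that, for all sufficiently large $n$, the passive testing dimension at $\varepsilon,\delta_n$ satisfies $d_{passive}(\mathcal P_n,D_n)\ge c\sqrt{n/\log n}$. 2. For every $k\in\mathbb N$ there is a constant $c>0$ such that for every $\varepsilon\in(0,1/2)$ there is a sequence $\delta_n\to0$ such that, for all sufficiently large $n$ and all $u\le n^k$, the active testing dimension at $\varepsilon,\delta_n$ satisfies $d_{active}(\mathcal P_n,D_n,u)\ge c\,(n/\log n)^{1/3}$. -/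

import Mathlib

open MeasureTheory ProbabilityTheory Filter Topology
open scoped ENNReal

noncomputable section

namespace PropertyTesting

/-- The distance `inf_{g ∈ P} Pr_{x ∼ D} [f x ≠ g x]` of `f` to the property `P`. -/
def distTo {X : Type*} [MeasurableSpace X] (D : Measure X) (f : X → Bool)
    (P : Set (X → Bool)) : ℝ≥0∞ :=
  ⨅ g ∈ P, D {x | f x ≠ g x}

/-- A distribution over boolean functions on `X`, given as a random function: `ω` is drawn from a
probability space and the function drawn is `eval ω`. Joint measurability makes every drawn function
measurable (so that its distance to a property makes sense), and makes the label distributions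
below measurable in the sample. -/
structure RandomFunction (X : Type*) [MeasurableSpace X] where
  Ω : Type
  [measurableSpace : MeasurableSpace Ω]
  μ : Measure Ω
  [isProbabilityMeasure : IsProbabilityMeasure μ]
  eval : Ω → X → Bool
  measurable_eval : Measurable (Function.uncurry eval)

attribute [instance] RandomFunction.measurableSpace RandomFunction.isProbabilityMeasure

namespace RandomFunction

variable {X : Type*} [MeasurableSpace X]

/-- `π_S(y)`: the probability that a function drawn from `π` labels the sample `S` by `y`. -/
def labelProb (π : RandomFunction X) {q : ℕ} (S : Fin q → X) (y : Fin q → Bool) : ℝ :=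
  π.μ.real {ω | ∀ i, π.eval ω (S i) = y i}

/-- The class `Π₀`: `π` is a distribution over functions in `P`. -/
def IsOver (π : RandomFunction X) (P : Set (X → Bool)) : Prop :=
  ∀ᵐ ω ∂π.μ, π.eval ω ∈ P

/-- The class `Π_ε` with explicit exceptional mass `δ`: under `π`, all but at most `δ` of the
probability mass is over functions at distance at least `ε` from `P`. -/
def IsFar (π : RandomFunction X) (D : Measure X) (P : Set (X → Bool)) (ε δ : ℝ) : Prop :=
  π.μ.real {ω | distTo D (π.eval ω) P < ENNReal.ofReal ε} ≤ δ

/-- `d_S(π, π')`: the variation distance between the label distributions of `π` and `π'` on `S`. -/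
def labelDist (π π' : RandomFunction X) {q : ℕ} (S : Fin q → X) : ℝ :=
  (1 / 2) * ∑ y : Fin q → Bool, |π.labelProb S y - π'.labelProb S y|

/-- The mass function of `Fair(π, π', U)` on labelled examples `(y, ℓ)`: with probability `1/2`
draw `y` from `π_U` and set `ℓ = 1`, with probability `1/2` draw `y` from `π'_U` and set `ℓ = 0`. -/
def fair (π π' : RandomFunction X) {u : ℕ} (U : Fin u → X) : (Fin u → Bool) × Bool → ℝ :=
  fun p => (1 / 2) * (if p.2 = true then π.labelProb U p.1 else π'.labelProb U p.1)

end RandomFunction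

/-- Decision trees over `{0,1}^u` with boolean outputs. -/
inductive DecisionTree (u : ℕ) where
  | leaf (b : Bool) : DecisionTree u
  | query (i : Fin u) (ifFalse ifTrue : DecisionTree u) : DecisionTree u

namespace DecisionTree

def depth {u : ℕ} : DecisionTree u → ℕ
  | leaf _ => 0
  | query _ s t => max s.depth t.depth + 1

def run {u : ℕ} : DecisionTree u → (Fin u → Bool) → Bool
  | leaf b, _ => b
  | query i s t, y => if y i = true then t.run y else s.run y

end DecisionTree

/-- `DT_q`: the functions on `{0,1}^u` computed by decision trees of depth at most `q`. -/
def DT (u q : ℕ) : Set ((Fin u → Bool) → Bool) :=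
  {h | ∃ T : DecisionTree u, T.depth ≤ q ∧ T.run = h}

/-- The probability that `h y ≠ ℓ` for a labelled example `(y, ℓ)` with mass function `p`. -/
def err {Y : Type*} [Fintype Y] (h : Y → Bool) (p : Y × Bool → ℝ) : ℝ :=
  ∑ z : Y × Bool, if h z.1 ≠ z.2 then p z else 0

/-- `err*(H, p)`: the error of the best function in `H`. -/
def errStar {Y : Type*} [Fintype Y] (H : Set (Y → Bool)) (p : Y × Bool → ℝ) : ℝ :=
  ⨅ h : H, err h.1 p

/-- The passive testing dimension of `P` over `D` at distance `ε`, with exceptional mass `δ`: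
the largest `q` for which there are `π ∈ Π₀` and `π' ∈ Π_ε` with
`Pr_{S ∼ D^q} (d_S(π, π') > 1/4) ≤ 1/4` (`⊤` if there are arbitrarily large such `q`). -/
def passiveDim {X : Type*} [MeasurableSpace X] (P : Set (X → Bool)) (D : Measure X)
    (ε δ : ℝ) : ℕ∞ :=
  ⨆ q ∈ {q : ℕ | ∃ π π' : RandomFunction X, π.IsOver P ∧ π'.IsFar D P ε δ ∧
    Measure.pi (fun _ : Fin q => D) {S | 1 / 4 < π.labelDist π' S} ≤ 1 / 4}, (q : ℕ∞)

/-- The active testing dimension of `P` over `D` with `u` unlabelled examples at distance `ε`,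
with exceptional mass `δ`: the largest `q` for which there are `π ∈ Π₀` and `π' ∈ Π_ε` with
`Pr_{U ∼ D^u} (err*(DT_q, Fair(π, π', U)) < 1/4) ≤ 1/4`
(`⊤` if there are arbitrarily large such `q`). -/
def activeDim {X : Type*} [MeasurableSpace X] (P : Set (X → Bool)) (D : Measure X)
    (u : ℕ) (ε δ : ℝ) : ℕ∞ :=
  ⨆ q ∈ {q : ℕ | ∃ π π' : RandomFunction X, π.IsOver P ∧ π'.IsFar D P ε δ ∧
    Measure.pi (fun _ : Fin u => D) {U | errStar (DT u q) (π.fair π' U) < 1 / 4} ≤ 1 / 4}, (q : ℕ∞)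

/-- Linear threshold functions `x ↦ sgn(w₁x₁ + ⋯ + wₙxₙ - θ)` on `ℝⁿ`, with `sgn` valued in
`{0,1}` and `sgn t = 1` iff `t ≥ 0`. -/
def LTF (n : ℕ) : Set (EuclideanSpace ℝ (Fin n) → Bool) :=
  {f | ∃ (w : Fin n → ℝ) (θ : ℝ), ∀ x, f x = true ↔ 0 ≤ ∑ i, w i * x i - θ}

end PropertyTesting

end

/-! Both bounds play a random homogeneous halfspace against a random colouring of a very fine
partition of space.

The colouring is the far distribution. Halfspaces are totally bounded in Gaussian `L¹`: up to
scaling, their parameters form a compact sphere, and boundary hyperplanes are null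
(`LTF_exists_finite_net`). Against each fixed function of a finite net, the colouring disagrees on
measure close to `1/2`, by Chebyshev with variance controlled by the largest cell mass. For each `n`
the cells may be as fine as desired, so for every `ε < 1/2` any prescribed exceptional mass `δ > 0`
is attained (`exists_randomColoring_isFar`). Sample points then rarely share a cell, and points in
distinct cells get exactly uniform labels. What remains is that halfspace labels are nearly uniform.

Active case, Gaussian normal vector. If `m‖t‖ ≤ ‖∑ tᵢxᵢ‖ ≤ l‖t‖` for all `t`, comparing Gaussian
densities bounds every sign pattern on `q` points by `(l/m)^q 2^{-q}` (`stdGaussian_signs_le`).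
Relative distortion `1/(4q)` of squared norms keeps the factor below `2`. A union bound over sets of
at most `q` points and over a grid of coefficients gives this distortion for all such sets at once
when `q log(uq)` is at most about `n/q²`; this is where the exponent `1/3` comes from. A one-sided
factor `2` on small cylinders passes to accepting sets of shallow trees and forces error at least
`1/4` (`errStar_fair_ge`).

Passive case, uniform sign normal vector. Only typical samples matter, so a second moment suffices:
`2^q ∑ π_S(y)²` averages to the mean of `(2 Pr[agree])^q` over two independent halfspaces. The
agreement probability exceeds `1/2` by at most `3|⟪σ,τ⟫|/n`, typically of order `n^{-1/2}`, so `q`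
may be of order `√n`, slightly more than required (`integral_sum_sq_le`, `le_passiveDim_LTF`). -/

namespace PropertyTesting

open scoped RealInnerProductSpace

/-! ### Gaussian measure of orthants and of their linear preimages -/

/-- The product of standard Gaussians on the line is absolutely
continuous, with the product density. -/
theorem pi_gaussianReal_eq_withDensity (ι : Type*) [Fintype ι] :
    Measure.pi (fun _ : ι => gaussianReal 0 1) =
      (volume : Measure (ι → ℝ)).withDensity
        (fun x => ENNReal.ofReal (∏ i, gaussianPDFReal 0 1 (x i))) := by
  refine Measure.pi_eq fun s hs => ?_
  rw [withDensity_apply _ (MeasurableSet.univ_pi hs), ← lintegral_indicator (MeasurableSet.univ_pi hs)]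
  have h1 : ∀ x : ι → ℝ, (Set.univ.pi s).indicator
      (fun x => ENNReal.ofReal (∏ i, gaussianPDFReal 0 1 (x i))) x =
      ENNReal.ofReal (∏ i, (s i).indicator (gaussianPDFReal 0 1) (x i)) := by
    intro x
    by_cases hx : x ∈ Set.univ.pi s
    · rw [Set.indicator_of_mem hx]
      congr 1
      refine Finset.prod_congr rfl fun i _ => ?_
      rw [Set.indicator_of_mem (hx i (Set.mem_univ i))]
    · rw [Set.indicator_of_notMem hx]
      simp only [Set.mem_univ_pi, not_forall] at hx
      obtain ⟨i, hi⟩ := hx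
      rw [Finset.prod_eq_zero (Finset.mem_univ i) (Set.indicator_of_notMem hi _), ENNReal.ofReal_zero]
  have hint : ∀ i, Integrable ((s i).indicator (gaussianPDFReal 0 1)) :=
    fun i => (integrable_gaussianPDFReal 0 1).indicator (hs i)
  have hnn : ∀ i x, 0 ≤ (s i).indicator (gaussianPDFReal 0 1) x :=
    fun i x => Set.indicator_nonneg (fun _ _ => gaussianPDFReal_nonneg 0 1 _) x
  simp_rw [h1]
  rw [volume_pi, ← ofReal_integral_eq_lintegral_ofReal (Integrable.fintype_prod hint)
    (ae_of_all _ fun x => Finset.prod_nonneg fun i _ => hnn i _),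
    integral_fintype_prod_eq_prod, ENNReal.ofReal_prod_of_nonneg
      (fun i _ => integral_nonneg (hnn i))]
  refine Finset.prod_congr rfl fun i _ => ?_
  rw [integral_indicator (hs i), gaussianReal_apply_eq_integral 0 one_ne_zero]

/-- The density of the standard Gaussian. -/
noncomputable def stdGaussianDensity {E : Type*} [NormedAddCommGroup E] (d : ℕ) (x : E) : ℝ≥0∞ :=
  ENNReal.ofReal ((√(2 * Real.pi))⁻¹ ^ d * Real.exp (-‖x‖ ^ 2 / 2))

theorem stdGaussian_eq_withDensity (ι : Type*) [Fintype ι] :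
    stdGaussian (EuclideanSpace ℝ ι) =
      volume.withDensity (stdGaussianDensity (Fintype.card ι)) := by
  rw [← map_pi_eq_stdGaussian, pi_gaussianReal_eq_withDensity]
  have hmp := (EuclideanSpace.volume_preserving_symm_measurableEquiv_toLp ι).symm
  ext s hs
  have hs' : MeasurableSet ((WithLp.toLp 2 : (ι → ℝ) → EuclideanSpace ℝ ι) ⁻¹' s) :=
    (by fun_prop : Measurable (WithLp.toLp 2 : (ι → ℝ) → EuclideanSpace ℝ ι)) hs
  rw [Measure.map_apply (by fun_prop) hs, withDensity_apply _ hs', withDensity_apply _ hs,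
    ← hmp.setLIntegral_comp_preimage_emb (MeasurableEquiv.measurableEmbedding _)]
  refine setLIntegral_congr_fun hs' fun x _ => ?_
  simp only [stdGaussianDensity, gaussianPDFReal, sub_zero, NNReal.coe_one, mul_one,
    Finset.prod_mul_distrib, Finset.prod_const, Finset.card_univ, ← Real.exp_sum]
  congr 3
  simp [EuclideanSpace.real_norm_sq_eq, Finset.sum_neg_distrib, Finset.sum_div, neg_div]

theorem stdGaussian_absolutelyContinuous (ι : Type*) [Fintype ι] :
    stdGaussian (EuclideanSpace ℝ ι) ≪ volume := by
  rw [stdGaussian_eq_withDensity]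
  exact withDensity_absolutelyContinuous _ _

/-- The pattern of signs `y`, as a set of points. -/
def orthant {ι : Type*} (y : ι → Bool) : Set (EuclideanSpace ℝ ι) :=
  {z | ∀ i, (0 ≤ z i ↔ y i = true)}

theorem measurableSet_orthant {ι : Type*} [Fintype ι] (y : ι → Bool) :
    MeasurableSet (orthant y) := by
  have : orthant y = ⋂ i, {z : EuclideanSpace ℝ ι | (0 ≤ z i ↔ y i = true)} := by
    ext; simp [orthant]
  rw [this]
  refine MeasurableSet.iInter fun i => ?_
  cases h : y i
  · simpa using measurableSet_lt (f := fun z : EuclideanSpace ℝ ι => z i) (by fun_prop) measurable_const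
  · simpa using measurableSet_le measurable_const (g := fun z : EuclideanSpace ℝ ι => z i) (by fun_prop)

theorem gaussianReal_Ici_zero : gaussianReal 0 1 (Set.Ici (0 : ℝ)) = 2⁻¹ := by
  have hmap : (gaussianReal 0 1).map (fun x : ℝ => -x) = gaussianReal 0 1 := by
    rw [gaussianReal_map_neg, neg_zero]
  have h1 : gaussianReal 0 1 (Set.Iio (0 : ℝ)) = gaussianReal 0 1 (Set.Ici (0 : ℝ)) := by
    have : NullSingletonClass (gaussianReal 0 1) := nullSingletonClass_gaussianReal one_ne_zero
    conv_lhs => rw [← hmap, Measure.map_apply measurable_neg measurableSet_Iio]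
    rw [← Ioi_ae_eq_Ici.measure_eq]
    congr 1
    ext; simp
  have h2 : gaussianReal 0 1 (Set.Iio (0 : ℝ)) + gaussianReal 0 1 (Set.Ici (0 : ℝ)) = 1 := by
    rw [← measure_union (by
      rw [Set.disjoint_left]; intro x hx hx'; exact (Set.mem_Iio.mp hx).not_ge hx') measurableSet_Ici,
      Set.Iio_union_Ici, measure_univ]
  rw [h1, ← two_mul] at h2
  exact ENNReal.eq_inv_of_mul_eq_one_left (by rwa [mul_comm])

theorem gaussianReal_Iio_zero : gaussianReal 0 1 (Set.Iio (0 : ℝ)) = 2⁻¹ := by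
  rw [← Set.compl_Ici, prob_compl_eq_one_sub measurableSet_Ici, gaussianReal_Ici_zero,
    ENNReal.one_sub_inv_two]

theorem stdGaussian_orthant {ι : Type*} [Fintype ι] (y : ι → Bool) :
    stdGaussian (EuclideanSpace ℝ ι) (orthant y) = 2⁻¹ ^ Fintype.card ι := by
  rw [← map_pi_eq_stdGaussian, Measure.map_apply (by fun_prop) (measurableSet_orthant y)]
  have : (WithLp.toLp 2 : (ι → ℝ) → EuclideanSpace ℝ ι) ⁻¹' orthant y =
      Set.univ.pi fun i => if y i = true then Set.Ici 0 else Set.Iio 0 := by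
    ext z
    simp only [orthant, Set.mem_preimage, Set.mem_ofPred_eq, Set.mem_univ_pi]
    refine forall_congr' fun i => ?_
    cases y i <;> simp
  rw [this, Measure.pi_pi, ← Finset.card_univ]
  refine Finset.prod_eq_pow_card fun i _ => ?_
  split_ifs
  · exact gaussianReal_Ici_zero
  · exact gaussianReal_Iio_zero

/-- Pulling back a nonnegative function along an expanding linear map. -/
theorem lintegral_comp_linearMap_le {ι : Type*} [Fintype ι]
    (S : EuclideanSpace ℝ ι →ₗ[ℝ] EuclideanSpace ℝ ι) {d : ℝ} (hd : 0 < d)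
    (hS : d ≤ |LinearMap.det S|) {h : EuclideanSpace ℝ ι → ℝ≥0∞} (hh : Measurable h) :
    ∫⁻ z, h (S z) ≤ ENNReal.ofReal d⁻¹ * ∫⁻ z, h z := by
  have hdet : LinearMap.det S ≠ 0 := abs_pos.mp (hd.trans_le hS)
  have hSm : Measurable S := S.continuous_of_finiteDimensional.measurable
  rw [← lintegral_map hh hSm, Measure.map_linearMap_addHaar_eq_smul_addHaar _ hdet,
    lintegral_smul_measure, smul_eq_mul]
  gcongr
  rw [abs_inv]
  exact inv_anti₀ hd hS

/-- An expanding linear map has a large determinant. -/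
theorem pow_le_abs_det {ι : Type*} [Fintype ι]
    (S : EuclideanSpace ℝ ι →ₗ[ℝ] EuclideanSpace ℝ ι) {m : ℝ} (hm : 0 < m)
    (hS : ∀ z, m * ‖z‖ ≤ ‖S z‖) : m ^ Fintype.card ι ≤ |LinearMap.det S| := by
  have hinj : Function.Injective S := by
    refine (injective_iff_map_eq_zero S).mpr fun z hz => ?_
    have := hS z
    rw [hz, norm_zero] at this
    exact norm_eq_zero.mp (le_antisymm (nonpos_of_mul_nonpos_right this hm) (norm_nonneg _))
  have hsurj := LinearMap.surjective_of_injective hinj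
  -- The image of the unit ball contains the ball of radius `m`; comparing volumes bounds the
  -- determinant from below.
  have hsub : Metric.ball (0 : EuclideanSpace ℝ ι) (m * 1) ⊆ S '' Metric.ball 0 1 := by
    intro w hw
    obtain ⟨z, rfl⟩ := hsurj w
    refine ⟨z, ?_, rfl⟩
    rw [mem_ball_zero_iff] at hw ⊢
    exact lt_of_mul_lt_mul_left ((hS z).trans_lt hw) hm.le
  have hvol := measure_mono (μ := (volume : Measure (EuclideanSpace ℝ ι))) hsub
  rw [Measure.addHaar_image_linearMap, Measure.addHaar_ball_mul_of_pos _ _ hm,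
    ENNReal.mul_le_mul_iff_left (Metric.measure_ball_pos _ _ one_pos).ne'
      measure_ball_lt_top.ne, finrank_euclideanSpace] at hvol
  exact (ENNReal.ofReal_le_ofReal_iff (abs_nonneg _)).mp hvol

/-- Orthants are cones, so rescaling the Gaussian does not change their probability. -/
theorem orthant_smul {ι : Type*} (y : ι → Bool) {l : ℝ} (hl : 0 < l) (z : EuclideanSpace ℝ ι) :
    l • z ∈ orthant y ↔ z ∈ orthant y := by
  simp [orthant, mul_nonneg_iff_of_pos_left hl]

theorem measurable_stdGaussianDensity {E : Type*} [NormedAddCommGroup E] [MeasurableSpace E]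
    [BorelSpace E] (d : ℕ) : Measurable (stdGaussianDensity (E := E) d) := by
  unfold stdGaussianDensity
  fun_prop

/-- The probability of a sign pattern under a linear image of the standard Gaussian. -/
theorem stdGaussian_preimage_orthant_le {ι : Type*} [Fintype ι]
    (S : EuclideanSpace ℝ ι →ₗ[ℝ] EuclideanSpace ℝ ι) {m l : ℝ} (hm : 0 < m) (hl : 0 < l)
    (hdet : m ^ Fintype.card ι ≤ |LinearMap.det S|) (hS' : ∀ z, ‖S z‖ ≤ l * ‖z‖) (y : ι → Bool) :
    stdGaussian (EuclideanSpace ℝ ι) (S ⁻¹' orthant y) ≤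
      ENNReal.ofReal ((l / m) ^ Fintype.card ι) * 2⁻¹ ^ Fintype.card ι := by
  set q := Fintype.card ι with hq
  have hSm : Measurable S := S.continuous_of_finiteDimensional.measurable
  have hO := measurableSet_orthant y
  have hφ := measurable_stdGaussianDensity (E := EuclideanSpace ℝ ι) q
  let h : EuclideanSpace ℝ ι → ℝ≥0∞ :=
    (orthant y).indicator fun z => stdGaussianDensity q (l⁻¹ • z)
  have hh : Measurable h := (hφ.comp (measurable_const_smul l⁻¹)).indicator hO
  have hstep1 : stdGaussian (EuclideanSpace ℝ ι) (S ⁻¹' orthant y) ≤ ∫⁻ z, h (S z) := by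
    rw [stdGaussian_eq_withDensity, withDensity_apply _ (hSm hO), ← lintegral_indicator (hSm hO)]
    -- Since `‖S z‖ ≤ l * ‖z‖`, the density at `l⁻¹ • S z` is at least the density at `z`. The
    -- integrand becomes a function of `S z`, and a change of variables costs only the determinant.
    refine lintegral_mono fun z => ?_
    by_cases hz : S z ∈ orthant y
    · rw [Set.indicator_of_mem (by exact hz)]
      simp only [h, Set.indicator_of_mem hz, stdGaussianDensity]
      refine ENNReal.ofReal_le_ofReal ?_
      gcongr
      rw [norm_smul, norm_inv, Real.norm_of_nonneg hl.le, inv_mul_le_iff₀ hl]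
      exact hS' z
    · rw [Set.indicator_of_notMem (by exact hz)]
      exact zero_le
  have hdet' : l⁻¹ ^ q ≤ |LinearMap.det (l⁻¹ • (LinearMap.id : EuclideanSpace ℝ ι →ₗ[ℝ] _))| := by
    rw [LinearMap.det_smul, LinearMap.det_id, mul_one, finrank_euclideanSpace, abs_of_pos (by positivity)]
  have hstep2 : ∫⁻ z, h z ≤ ENNReal.ofReal (l ^ q) * 2⁻¹ ^ q := by
    have h2 := lintegral_comp_linearMap_le (l⁻¹ • (LinearMap.id : EuclideanSpace ℝ ι →ₗ[ℝ] _))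
      (by positivity) hdet' (hφ.indicator hO)
    rw [inv_pow, inv_inv, lintegral_indicator hO, ← withDensity_apply _ hO,
      ← stdGaussian_eq_withDensity, stdGaussian_orthant] at h2
    refine le_trans (le_of_eq ?_) h2
    refine lintegral_congr fun z => ?_
    have := orthant_smul y (inv_pos.mpr hl) z
    by_cases hz : z ∈ orthant y
    · simp [h, Set.indicator_of_mem hz, Set.indicator_of_mem (this.mpr hz)]
    · simp [h, Set.indicator_of_notMem hz, Set.indicator_of_notMem (this.not.mpr hz)]
  calc stdGaussian (EuclideanSpace ℝ ι) (S ⁻¹' orthant y) ≤ ∫⁻ z, h (S z) := hstep1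
    _ ≤ ENNReal.ofReal (m ^ q)⁻¹ * ∫⁻ z, h z :=
        lintegral_comp_linearMap_le S (by positivity) hdet hh
    _ ≤ ENNReal.ofReal (m ^ q)⁻¹ * (ENNReal.ofReal (l ^ q) * 2⁻¹ ^ q) := by gcongr
    _ = _ := by
        rw [← mul_assoc, ← ENNReal.ofReal_mul (by positivity), div_pow, div_eq_inv_mul]

/-- The law of the coordinates of a standard Gaussian along vectors `x i` is that of a linear image
of the standard Gaussian in the index space. -/
theorem exists_map_inner_eq {ι : Type*} [Fintype ι] {E : Type*} [NormedAddCommGroup E]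
    [InnerProductSpace ℝ E] [FiniteDimensional ℝ E] [MeasurableSpace E] [BorelSpace E]
    (T : EuclideanSpace ℝ ι →ₗ[ℝ] E) (hT : Function.Injective T) :
    ∃ R : EuclideanSpace ℝ ι →ₗ[ℝ] EuclideanSpace ℝ ι, (∀ t, ‖R t‖ = ‖T t‖) ∧
      (stdGaussian E).map (LinearMap.adjoint T) =
        (stdGaussian (EuclideanSpace ℝ ι)).map (LinearMap.adjoint R) := by
  have hfr : Module.finrank ℝ (LinearMap.range T) = Fintype.card ι := by
    rw [LinearMap.finrank_range_of_inj hT, finrank_euclideanSpace]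
  let b := (stdOrthonormalBasis ℝ (LinearMap.range T)).reindex
    (Fintype.equivOfCardEq (by rw [Fintype.card_fin, hfr]) : _ ≃ ι)
  -- Identifying the range of `T` isometrically with the index space keeps `‖T t‖`, and the
  -- characteristic function `exp (-‖T t‖² / 2)` of the adjoint image depends on nothing else.
  let R : EuclideanSpace ℝ ι →ₗ[ℝ] EuclideanSpace ℝ ι :=
    b.repr.toLinearEquiv.toLinearMap ∘ₗ T.rangeRestrict
  have hR : ∀ t, ‖R t‖ = ‖T t‖ := fun t => by
    change ‖b.repr (T.rangeRestrict t)‖ = _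
    rw [LinearIsometryEquiv.norm_map]
    rfl
  have hm1 : Measurable (LinearMap.adjoint T) :=
    (LinearMap.adjoint T).continuous_of_finiteDimensional.measurable
  have hm2 : Measurable (LinearMap.adjoint R) :=
    (LinearMap.adjoint R).continuous_of_finiteDimensional.measurable
  refine ⟨R, hR, ?_⟩
  have := Measure.isProbabilityMeasure_map (μ := stdGaussian E) hm1.aemeasurable
  have := Measure.isProbabilityMeasure_map
    (μ := stdGaussian (EuclideanSpace ℝ ι)) hm2.aemeasurable
  refine Measure.ext_of_charFun (funext fun t => ?_)
  rw [charFun_apply, charFun_apply, integral_map hm1.aemeasurable (by fun_prop),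
    integral_map hm2.aemeasurable (by fun_prop)]
  simp_rw [LinearMap.adjoint_inner_left]
  rw [← charFun_apply, ← charFun_apply, charFun_stdGaussian, charFun_stdGaussian, hR]

/-- Almost orthogonal vectors are labelled almost uniformly by a random halfspace. -/
theorem stdGaussian_signs_le {ι : Type*} [Fintype ι] {E : Type*} [NormedAddCommGroup E]
    [InnerProductSpace ℝ E] [FiniteDimensional ℝ E] [MeasurableSpace E] [BorelSpace E]
    (x : ι → E) {m l : ℝ} (hm : 0 < m) (hl : 0 < l)
    (h : ∀ t : EuclideanSpace ℝ ι, m * ‖t‖ ≤ ‖∑ i, t i • x i‖)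
    (h' : ∀ t : EuclideanSpace ℝ ι, ‖∑ i, t i • x i‖ ≤ l * ‖t‖) (y : ι → Bool) :
    (stdGaussian E).real {w | ∀ i, (0 ≤ ⟪x i, w⟫ ↔ y i = true)} ≤
      (l / m) ^ Fintype.card ι / 2 ^ Fintype.card ι := by
  classical
  let T : EuclideanSpace ℝ ι →ₗ[ℝ] E :=
    { toFun := fun t => ∑ i, t i • x i
      map_add' := fun s t => by simp [add_smul, Finset.sum_add_distrib]
      map_smul' := fun c t => by simp [Finset.smul_sum, smul_smul] }
  have hT : Function.Injective T := by
    refine (injective_iff_map_eq_zero T).mpr fun z hz => ?_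
    have h0 : m * ‖z‖ ≤ ‖T z‖ := h z
    rw [hz, norm_zero] at h0
    exact norm_eq_zero.mp (le_antisymm (nonpos_of_mul_nonpos_right h0 hm) (norm_nonneg _))
  obtain ⟨R, hR, hmap⟩ := exists_map_inner_eq T hT
  have hadj : ∀ w i, (LinearMap.adjoint T w) i = ⟪x i, w⟫ := fun w i => by
    have h1 : (LinearMap.adjoint T w) i = ⟪EuclideanSpace.single i (1 : ℝ), LinearMap.adjoint T w⟫ := by
      simp [EuclideanSpace.inner_single_left]
    rw [h1, LinearMap.adjoint_inner_right]
    congr 1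
    change ∑ j, (EuclideanSpace.single i (1 : ℝ)) j • x j = x i
    rw [Finset.sum_eq_single i] <;> simp +contextual
  have hset : {w | ∀ i, (0 ≤ ⟪x i, w⟫ ↔ y i = true)} = LinearMap.adjoint T ⁻¹' orthant y := by
    ext w
    simp [orthant, hadj]
  have hm1 : Measurable (LinearMap.adjoint T) :=
    (LinearMap.adjoint T).continuous_of_finiteDimensional.measurable
  have hm2 : Measurable (LinearMap.adjoint R) :=
    (LinearMap.adjoint R).continuous_of_finiteDimensional.measurable
  have hdet : m ^ Fintype.card ι ≤ |LinearMap.det (LinearMap.adjoint R)| := by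
    have hd : LinearMap.det (LinearMap.adjoint R) = LinearMap.det R := by
      have := LinearMap.toMatrix_adjoint (EuclideanSpace.basisFun ι ℝ) (EuclideanSpace.basisFun ι ℝ) R
      rw [← LinearMap.det_toMatrix (EuclideanSpace.basisFun ι ℝ).toBasis, this,
        Matrix.conjTranspose_eq_transpose_of_trivial, Matrix.det_transpose, LinearMap.det_toMatrix]
    rw [hd]
    exact pow_le_abs_det R hm fun z => by rw [hR]; exact h z
  have hnorm : ∀ z, ‖LinearMap.adjoint R z‖ ≤ l * ‖z‖ := fun z => by
    have h1 : ‖LinearMap.adjoint R z‖ * ‖LinearMap.adjoint R z‖ ≤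
        (l * ‖z‖) * ‖LinearMap.adjoint R z‖ := by
      rw [← real_inner_self_eq_norm_mul_norm, LinearMap.adjoint_inner_left]
      calc ⟪z, R (LinearMap.adjoint R z)⟫ ≤ ‖z‖ * ‖R (LinearMap.adjoint R z)‖ :=
            real_inner_le_norm _ _
        _ ≤ ‖z‖ * (l * ‖LinearMap.adjoint R z‖) := by
            gcongr
            rw [hR]
            exact h' _
        _ = _ := by ring
    rcases (norm_nonneg (LinearMap.adjoint R z)).eq_or_lt with h0 | h0
    · rw [← h0]; positivity
    · exact le_of_mul_le_mul_right h1 h0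
  rw [hset, measureReal_def, ← Measure.map_apply hm1 (measurableSet_orthant y), hmap,
    Measure.map_apply hm2 (measurableSet_orthant y)]
  refine ENNReal.toReal_le_of_le_ofReal (by positivity) ?_
  refine (stdGaussian_preimage_orthant_le _ hm hl hdet hnorm y).trans (le_of_eq ?_)
  rw [div_eq_mul_inv _ ((2 : ℝ) ^ Fintype.card ι), ENNReal.ofReal_mul (by positivity), ← inv_pow,
    ENNReal.ofReal_pow (p := (2 : ℝ)⁻¹) (by norm_num), ENNReal.ofReal_inv_of_pos two_pos, ENNReal.ofReal_ofNat]

/-! ### Halfspaces and their total boundedness -/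

/-- The halfspace with normal vector `p.1` and threshold `p.2`. -/
noncomputable def halfspace {n : ℕ} (p : EuclideanSpace ℝ (Fin n) × ℝ) : EuclideanSpace ℝ (Fin n) → Bool :=
  fun x => decide (0 ≤ ⟪p.1, x⟫ - p.2)

theorem measurable_uncurry_halfspace {n : ℕ} :
    Measurable (Function.uncurry (halfspace (n := n))) := by
  refine measurable_to_bool ?_
  have : Function.uncurry (halfspace (n := n)) ⁻¹' {true} = {z | 0 ≤ ⟪z.1.1, z.2⟫ - z.1.2} := by
    ext z
    simp [halfspace, Function.uncurry]
  rw [this]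
  exact (isClosed_le continuous_const (by fun_prop)).measurableSet

theorem measurable_halfspace {n : ℕ} (p : EuclideanSpace ℝ (Fin n) × ℝ) :
    Measurable (halfspace p) :=
  measurable_uncurry_halfspace.of_uncurry_left

theorem inner_eq_sum {n : ℕ} (w x : EuclideanSpace ℝ (Fin n)) : ⟪w, x⟫ = ∑ i, w i * x i := by
  simp [PiLp.inner_apply, mul_comm]

theorem halfspace_mem_LTF {n : ℕ} (p : EuclideanSpace ℝ (Fin n) × ℝ) : halfspace p ∈ LTF n :=
  ⟨p.1, p.2, fun x => by simp [halfspace, inner_eq_sum]⟩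

/-- Positive rescaling of the parameters does not change the function, which makes the parameter
space compact. The zero parameter cannot be rescaled, but it gives the constant `true`, also given
by normal `0` and threshold `-1`. -/
theorem exists_halfspace_of_mem_LTF {n : ℕ} {f : EuclideanSpace ℝ (Fin n) → Bool}
    (hf : f ∈ LTF n) : ∃ p ∈ Metric.sphere (0 : EuclideanSpace ℝ (Fin n) × ℝ) 1, f = halfspace p := by
  obtain ⟨w, θ, h⟩ := hf
  by_cases h0 : ((WithLp.toLp 2 w, θ) : EuclideanSpace ℝ (Fin n) × ℝ) = 0
  · refine ⟨(0, -1), by simp [Prod.norm_def], ?_⟩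
    have hw : w = 0 := by simpa using congrArg Prod.fst h0
    have hθ : θ = 0 := congrArg Prod.snd h0
    ext x
    rw [Bool.eq_iff_iff, h x]
    simp [halfspace, hw, hθ]
  · set p : EuclideanSpace ℝ (Fin n) × ℝ := (WithLp.toLp 2 w, θ) with hp
    have hp0 : 0 < ‖p‖ := norm_pos_iff.mpr h0
    refine ⟨‖p‖⁻¹ • p, by simp [norm_smul, hp0.ne'], ?_⟩
    ext x
    rw [Bool.eq_iff_iff, h x]
    simp only [halfspace, decide_eq_true_eq, Prod.smul_fst, Prod.smul_snd, real_inner_smul_left,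
      smul_eq_mul, ← mul_sub]
    rw [mul_nonneg_iff_of_pos_left (inv_pos.mpr hp0), inner_eq_sum]

theorem stdGaussian_hyperplane {n : ℕ} {p : EuclideanSpace ℝ (Fin n) × ℝ} (hp : p ≠ 0) :
    ∀ᵐ x ∂stdGaussian (EuclideanSpace ℝ (Fin n)), ⟪p.1, x⟫ - p.2 ≠ 0 := by
  by_cases h1 : p.1 = 0
  · have h2 : p.2 ≠ 0 := fun h => hp (Prod.ext h1 h)
    exact ae_of_all _ fun x => by simpa [h1] using h2
  refine (stdGaussian_absolutelyContinuous (Fin n)).ae_le ?_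
  let s : AffineSubspace ℝ (EuclideanSpace ℝ (Fin n)) :=
    { carrier := {x | ⟪p.1, x⟫ - p.2 = 0}
      smul_vsub_vadd_mem' := by
        intro c x y z hx hy hz
        simp only [Set.mem_ofPred_eq, vsub_eq_sub, vadd_eq_add, inner_add_right, inner_smul_right,
          inner_sub_right] at hx hy hz ⊢
        linear_combination c * hx - c * hy + hz }
  have hs : s ≠ ⊤ := by
    intro h
    have ha : ∀ x, ⟪p.1, x⟫ - p.2 = 0 := fun x => by
      have : x ∈ s := h ▸ AffineSubspace.mem_top _ _ _
      exact this
    have h3 := ha 0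
    have h4 := ha p.1
    rw [inner_zero_right] at h3
    have : ⟪p.1, p.1⟫ = 0 := by linarith
    exact h1 (inner_self_eq_zero.mp this)
  have := Measure.addHaar_affineSubspace (volume : Measure (EuclideanSpace ℝ (Fin n))) s hs
  rw [mem_ae_iff]
  refine measure_mono_null (fun x hx => ?_) this
  exact not_not.mp hx

theorem measurableSet_ne {X : Type*} [MeasurableSpace X] {f g : X → Bool} (hf : Measurable f)
    (hg : Measurable g) : MeasurableSet {x | f x ≠ g x} :=
  (measurableSet_eq_fun hf hg).compl

/-- Off the null hyperplane the sign at `x` is locally constant in the parameters, so the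
disagreement indicators tend to zero almost everywhere. -/
theorem tendsto_halfspace {n : ℕ} {p : EuclideanSpace ℝ (Fin n) × ℝ} (hp : p ≠ 0) :
    Tendsto (fun p' => stdGaussian (EuclideanSpace ℝ (Fin n)) {x | halfspace p x ≠ halfspace p' x})
      (𝓝 p) (𝓝 0) := by
  rw [← measure_empty (μ := stdGaussian (EuclideanSpace ℝ (Fin n)))]
  refine tendsto_measure_of_ae_tendsto_indicator_of_isFiniteMeasure _ MeasurableSet.empty
    (fun p' => measurableSet_ne (measurable_halfspace p) (measurable_halfspace p')) ?_
  filter_upwards [stdGaussian_hyperplane hp] with x hx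
  have hc : Tendsto (fun p' : EuclideanSpace ℝ (Fin n) × ℝ => ⟪p'.1, x⟫ - p'.2) (𝓝 p)
      (𝓝 (⟪p.1, x⟫ - p.2)) := Continuous.tendsto (by fun_prop) p
  rcases lt_or_gt_of_ne hx with h | h
  · filter_upwards [hc.eventually_lt_const h] with p' hp'
    simp [halfspace, h.not_ge, hp'.not_ge]
  · filter_upwards [hc.eventually_const_lt h] with p' hp'
    simp [halfspace, h.le, hp'.le]

/-- Halfspaces are totally bounded in `L¹` of the Gaussian. -/
theorem LTF_exists_finite_net (n : ℕ) {η : ℝ≥0∞} (hη : 0 < η) :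
    ∃ G : Finset (EuclideanSpace ℝ (Fin n) → Bool), (∀ g ∈ G, Measurable g) ∧
      ∀ f ∈ LTF n, ∃ g ∈ G, stdGaussian (EuclideanSpace ℝ (Fin n)) {x | g x ≠ f x} < η := by
  classical
  obtain ⟨t, -, ht⟩ := (isCompact_sphere (0 : EuclideanSpace ℝ (Fin n) × ℝ) 1).elim_nhds_subcover
    (fun p => {p' | stdGaussian (EuclideanSpace ℝ (Fin n)) {x | halfspace p x ≠ halfspace p' x} < η})
    (fun p hp => (tendsto_halfspace (fun h => by simp [h] at hp)).eventually_lt_const hη)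
  refine ⟨t.image halfspace, ?_, fun f hf => ?_⟩
  · simp only [Finset.mem_image, forall_exists_index, and_imp]
    rintro _ p - rfl
    exact measurable_halfspace p
  · obtain ⟨p', hp', rfl⟩ := exists_halfspace_of_mem_LTF hf
    obtain ⟨p, hp, hpp⟩ := Set.mem_iUnion₂.mp (ht hp')
    exact ⟨halfspace p, Finset.mem_image_of_mem _ hp, hpp⟩

/-! ### Random colourings: uniform labels and distance from halfspaces -/

/-- The fair coin. -/
noncomputable def coin : Measure Bool := (2⁻¹ : ℝ≥0∞) • Measure.count

theorem coin_singleton (b : Bool) : coin {b} = 2⁻¹ := by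
  simp [coin]

instance : IsProbabilityMeasure coin :=
  ⟨by
    have h : (Set.univ : Set Bool) = {false} ∪ {true} := by ext b; cases b <;> simp
    rw [h, measure_union (by simp) (measurableSet_singleton _), coin_singleton, coin_singleton,
      ENNReal.inv_two_add_inv_two]⟩

/-- Colour the cells of a countable partition at random. -/
noncomputable def randomColoring {X : Type*} [MeasurableSpace X] (cell : X → ℤ) (hc : Measurable cell) :
    RandomFunction X where
  Ω := ℤ → Bool
  μ := Measure.infinitePi fun _ => coin
  eval ω x := ω (cell x)
  measurable_eval := by
    have h1 : Measurable fun p : (ℤ → Bool) × ℤ => p.1 p.2 :=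
      measurable_from_prod_countable_left fun j => measurable_pi_apply j
    exact h1.comp (measurable_fst.prodMk (hc.comp measurable_snd))

/-- Labels of points in distinct cells are uniform. -/
theorem randomColoring_cylinder {X : Type*} [MeasurableSpace X] (cell : X → ℤ) (hc : Measurable cell)
    {ι : Type*} (S : ι → X) (A : Finset ι) (hS : Set.InjOn (fun i => cell (S i)) A) (y : ι → Bool) :
    (randomColoring cell hc).μ.real {ω | ∀ i ∈ A, (randomColoring cell hc).eval ω (S i) = y i} =
      (2⁻¹ : ℝ) ^ A.card := by
  classical
  have hset : {ω : ℤ → Bool | ∀ i ∈ A, ω (cell (S i)) = y i} =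
      Set.pi (A.image fun i => cell (S i) : Finset ℤ)
        (fun j => {b | ∀ i ∈ A, cell (S i) = j → b = y i}) := by
    ext ω
    simp only [Set.mem_ofPred_eq, Set.mem_pi, Finset.mem_coe, Finset.mem_image]
    constructor
    · rintro h _ - i hi rfl
      exact h i hi
    · intro h i hi
      exact h _ ⟨i, hi, rfl⟩ i hi rfl
  have h2 : (Measure.infinitePi fun _ : ℤ => coin) {ω : ℤ → Bool | ∀ i ∈ A, ω (cell (S i)) = y i} =
      2⁻¹ ^ A.card := by
    rw [hset, Measure.infinitePi_pi _ (fun _ _ => MeasurableSet.of_discrete),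
      Finset.prod_image hS]
    refine Finset.prod_eq_pow_card fun i hi => ?_
    rw [← coin_singleton (y i)]
    congr 1
    ext b
    simp only [Set.mem_ofPred_eq, Set.mem_singleton_iff]
    refine ⟨fun h => h i hi rfl, ?_⟩
    rintro rfl i' hi' hii
    rw [hS hi' hi hii]
  change ((Measure.infinitePi fun _ : ℤ => coin) _).toReal = _
  rw [show {ω | ∀ i ∈ A, (randomColoring cell hc).eval ω (S i) = y i} =
    {ω : ℤ → Bool | ∀ i ∈ A, ω (cell (S i)) = y i} from rfl, h2]
  simp

theorem randomColoring_labelProb {X : Type*} [MeasurableSpace X] (cell : X → ℤ) (hc : Measurable cell)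
    {q : ℕ} (S : Fin q → X) (hS : Function.Injective fun i => cell (S i)) (y : Fin q → Bool) :
    (randomColoring cell hc).labelProb S y = (2⁻¹ : ℝ) ^ q := by
  have := randomColoring_cylinder cell hc S Finset.univ hS.injOn y
  simpa [RandomFunction.labelProb] using this

/-- `±1/2` according to whether `a` and `b` differ. -/
noncomputable def halfSign (a b : Bool) : ℝ := if a ≠ b then 1 / 2 else -(1 / 2)

theorem abs_halfSign (a b : Bool) : |halfSign a b| = 1 / 2 := by
  unfold halfSign; split_ifs <;> norm_num

theorem integral_halfSign_coin (b : Bool) : ∫ a, halfSign a b ∂coin = 0 := by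
  have hr : ∀ a : Bool, coin.real {a} = 1 / 2 := fun a => by
    rw [measureReal_def, coin_singleton]; simp
  rw [integral_fintype (Integrable.of_finite)]
  cases b <;> simp [hr, halfSign]

/-- Colours of distinct cells are independent and `halfSign` has mean zero under the coin. This
kills the off-diagonal part of the variance of the disagreement. -/
theorem integral_halfSign_mul_halfSign {i j : ℤ} (h : i ≠ j) (a b : Bool) :
    ∫ ω : ℤ → Bool, halfSign (ω i) a * halfSign (ω j) b ∂(Measure.infinitePi fun _ => coin) = 0 := by
  have hind : iIndepFun (fun (i : ℤ) (ω : ℤ → Bool) => ω i) (Measure.infinitePi fun _ => coin) :=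
    iIndepFun_infinitePi (P := fun _ : ℤ => coin) (X := fun _ b => b) fun _ => measurable_id
  have hm : ∀ c, Measurable fun b : Bool => halfSign b c := fun c => measurable_of_finite _
  have h2 := (hind.indepFun h).comp (hm a) (hm b)
  have h3 := h2.integral_fun_mul_eq_mul_integral
    ((hm a).comp (measurable_pi_apply i)).aestronglyMeasurable
    ((hm b).comp (measurable_pi_apply j)).aestronglyMeasurable
  simp only [Function.comp_def] at h3
  rw [h3]
  have h4 : ∫ ω : ℤ → Bool, halfSign (ω i) a ∂(Measure.infinitePi fun _ => coin) = 0 := by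
    have h5 := integral_map (μ := Measure.infinitePi fun _ : ℤ => coin)
      (measurable_pi_apply i).aemeasurable (hm a).aestronglyMeasurable
    rw [Measure.infinitePi_map_eval, integral_halfSign_coin] at h5
    exact h5.symm
  rw [h4, zero_mul]

/-- Two independent samples rarely lie in the same cell of a fine partition. -/
theorem prod_same_cell_le {X : Type*} [MeasurableSpace X] (D : Measure X) [IsProbabilityMeasure D]
    {cell : X → ℤ} (hc : Measurable cell) {κ : ℝ≥0∞} (hκ : ∀ j, D (cell ⁻¹' {j}) ≤ κ) :
    (D.prod D) {z | cell z.1 = cell z.2} ≤ κ := by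
  have hms : MeasurableSet {z : X × X | cell z.1 = cell z.2} :=
    measurableSet_eq_fun (hc.comp measurable_fst) (hc.comp measurable_snd)
  rw [Measure.prod_apply hms]
  calc ∫⁻ x, D (Prod.mk x ⁻¹' {z : X × X | cell z.1 = cell z.2}) ∂D ≤ ∫⁻ _, κ ∂D := by
        refine lintegral_mono fun x => le_trans (measure_mono ?_) (hκ (cell x))
        intro y hy
        exact hy.symm
    _ = κ := by simp

theorem measurable_halfSign : Measurable (Function.uncurry halfSign) := measurable_of_finite _

/-- A fixed function agrees with a random colouring on about half of the space. -/
theorem randomColoring_concentration {X : Type*} [MeasurableSpace X] (D : Measure X)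
    [IsProbabilityMeasure D] {cell : X → ℤ} (hc : Measurable cell) {κ : ℝ} (hκ0 : 0 ≤ κ)
    (hκ : ∀ j, D (cell ⁻¹' {j}) ≤ ENNReal.ofReal κ) {g : X → Bool} (hg : Measurable g) {η : ℝ}
    (hη : 0 < η) :
    (randomColoring cell hc).μ.real
      {ω | D.real {x | (randomColoring cell hc).eval ω x ≠ g x} ≤ 1 / 2 - η} ≤ κ / (4 * η ^ 2) := by
  set π := randomColoring cell hc with hπ
  have hme : Measurable fun z : π.Ω × X => halfSign (π.eval z.1 z.2) (g z.2) :=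
    measurable_halfSign.comp (π.measurable_eval.prodMk (hg.comp measurable_snd))
  have hm1 : ∀ ω, Measurable (π.eval ω) := fun ω => π.measurable_eval.of_uncurry_left
  -- The centred disagreement measure. Its square is a double integral over two points, whose
  -- expectation survives only when the points share a cell; Chebyshev then finishes.
  let F : π.Ω → ℝ := fun ω => ∫ x, halfSign (π.eval ω x) (g x) ∂D
  have hF : ∀ ω, F ω = D.real {x | π.eval ω x ≠ g x} - 1 / 2 := by
    intro ω
    have hs := measurableSet_ne (hm1 ω) hg
    have h1 : ∀ x, halfSign (π.eval ω x) (g x) =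
        {x | π.eval ω x ≠ g x}.indicator (fun _ => (1 : ℝ)) x - 1 / 2 := by
      intro x
      by_cases h : π.eval ω x ≠ g x
      · rw [Set.indicator_of_mem (by exact h), halfSign, if_pos h]; norm_num
      · rw [Set.indicator_of_notMem (by exact h), halfSign, if_neg h]; norm_num
    simp only [F, h1]
    rw [integral_sub ((integrable_const _).indicator hs) (integrable_const _),
      integral_indicator_const _ hs]
    simp
  have hsq : ∀ ω, F ω ^ 2 = ∫ z, halfSign (π.eval ω z.1) (g z.1) * halfSign (π.eval ω z.2) (g z.2)
      ∂(D.prod D) := by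
    intro ω
    rw [integral_prod_mul (fun x => halfSign (π.eval ω x) (g x))
      (fun x => halfSign (π.eval ω x) (g x)), sq]
  have hmz : Measurable (Function.uncurry fun (ω : π.Ω) (z : X × X) =>
      halfSign (π.eval ω z.1) (g z.1) * halfSign (π.eval ω z.2) (g z.2)) :=
    (hme.comp (measurable_fst.prodMk (measurable_fst.comp measurable_snd))).mul
      (hme.comp (measurable_fst.prodMk (measurable_snd.comp measurable_snd)))
  have hbd : ∀ (ω : π.Ω) (z : X × X),
      ‖halfSign (π.eval ω z.1) (g z.1) * halfSign (π.eval ω z.2) (g z.2)‖ ≤ 1 / 4 := by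
    intro ω z
    rw [norm_mul, Real.norm_eq_abs, Real.norm_eq_abs, abs_halfSign, abs_halfSign]
    norm_num
  have hms : MeasurableSet {z : X × X | cell z.1 = cell z.2} :=
    measurableSet_eq_fun (hc.comp measurable_fst) (hc.comp measurable_snd)
  have hinner : ∀ z : X × X,
      ∫ ω, halfSign (π.eval ω z.1) (g z.1) * halfSign (π.eval ω z.2) (g z.2) ∂π.μ ≤
        {z : X × X | cell z.1 = cell z.2}.indicator (fun _ => (1 / 4 : ℝ)) z := by
    intro z
    by_cases h : cell z.1 = cell z.2
    · rw [Set.indicator_of_mem (by exact h)]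
      refine (le_abs_self _).trans ((norm_integral_le_of_norm_le_const
        (ae_of_all _ fun ω => hbd ω z)).trans ?_)
      simp
    · rw [Set.indicator_of_notMem (by exact h)]
      exact (integral_halfSign_mul_halfSign h (g z.1) (g z.2)).le
  have hFsq : ∫ ω, F ω ^ 2 ∂π.μ ≤ κ / 4 := by
    have hint : Integrable (Function.uncurry fun (ω : π.Ω) (z : X × X) =>
        halfSign (π.eval ω z.1) (g z.1) * halfSign (π.eval ω z.2) (g z.2)) (π.μ.prod (D.prod D)) :=
      Integrable.of_bound hmz.aestronglyMeasurable (1 / 4) (ae_of_all _ fun z => hbd z.1 z.2)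
    simp_rw [hsq]
    rw [integral_integral_swap hint]
    calc _ ≤ ∫ z, {z : X × X | cell z.1 = cell z.2}.indicator (fun _ => (1 / 4 : ℝ)) z ∂(D.prod D) :=
          integral_mono hint.integral_prod_right ((integrable_const _).indicator hms) hinner
      _ = (D.prod D).real {z : X × X | cell z.1 = cell z.2} * (1 / 4) := by
          rw [integral_indicator_const _ hms, smul_eq_mul]
      _ ≤ κ * (1 / 4) := by
          gcongr
          exact ENNReal.toReal_le_of_le_ofReal hκ0 (prod_same_cell_le D hc hκ)
      _ = κ / 4 := by ring
  have hFm : Measurable F := (hme.stronglyMeasurable.integral_prod_right (ν := D)).measurable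
  have hFb : ∀ ω, ‖F ω‖ ≤ 1 / 2 := fun ω => by
    refine (norm_integral_le_of_norm_le_const (C := 1 / 2) (ae_of_all _ fun x => ?_)).trans ?_
    · rw [Real.norm_eq_abs, abs_halfSign]
    · simp
  have hFi : Integrable (fun ω => F ω ^ 2) π.μ := by
    refine Integrable.of_bound (hFm.pow_const 2).aestronglyMeasurable (1 / 4) (ae_of_all _ fun ω => ?_)
    rw [norm_pow]
    nlinarith [hFb ω, norm_nonneg (F ω)]
  have hM := mul_meas_ge_le_integral_of_nonneg (ae_of_all π.μ fun ω => sq_nonneg (F ω)) hFi (η ^ 2)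
  rw [le_div_iff₀ (by positivity)]
  have hsub : π.μ.real {ω | D.real {x | π.eval ω x ≠ g x} ≤ 1 / 2 - η} ≤
      π.μ.real {ω | η ^ 2 ≤ F ω ^ 2} := by
    refine measureReal_mono fun ω hω => ?_
    have h1 : F ω ≤ -η := by
      have : D.real {x | π.eval ω x ≠ g x} ≤ 1 / 2 - η := hω
      rw [hF]; linarith
    change η ^ 2 ≤ F ω ^ 2
    nlinarith
  nlinarith [sq_nonneg η]

/-- A random colouring of a fine partition is far from every totally bounded class. -/
theorem randomColoring_isFar {X : Type*} [MeasurableSpace X] (D : Measure X)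
    [IsProbabilityMeasure D] {P : Set (X → Bool)} {cell : X → ℤ} (hc : Measurable cell) {κ : ℝ}
    (hκ0 : 0 ≤ κ) (hκ : ∀ j, D (cell ⁻¹' {j}) ≤ ENNReal.ofReal κ) {ε η δ : ℝ} (hη : 0 < η) (hε : 0 < ε)
    (hεη : ε + η ≤ 1 / 2 - η) (G : Finset (X → Bool)) (hGm : ∀ g ∈ G, Measurable g)
    (hG : ∀ f ∈ P, ∃ g ∈ G, D {x | g x ≠ f x} < ENNReal.ofReal η)
    (hδ : G.card * (κ / (4 * η ^ 2)) ≤ δ) :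
    (randomColoring cell hc).IsFar D P ε δ := by
  set π := randomColoring cell hc with hπ
  have hsub : {ω | distTo D (π.eval ω) P < ENNReal.ofReal ε} ⊆
      ⋃ g ∈ G, {ω | D.real {x | π.eval ω x ≠ g x} ≤ 1 / 2 - η} := by
    intro ω hω
    have hω' : distTo D (π.eval ω) P < ENNReal.ofReal ε := hω
    rw [distTo, iInf_lt_iff] at hω'
    -- A colouring within `ε` of some `f` in the class is within `ε + η` of the net point of `f`, an
    -- unlikely event for each fixed net point.
    obtain ⟨f, hf⟩ := hω'
    rw [iInf_lt_iff] at hf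
    obtain ⟨hfP, hf⟩ := hf
    obtain ⟨g, hg, hgf⟩ := hG f hfP
    refine Set.mem_iUnion₂.mpr ⟨g, hg, ?_⟩
    refine le_trans ?_ hεη
    refine ENNReal.toReal_le_of_le_ofReal (by positivity) ?_
    rw [ENNReal.ofReal_add hε.le hη.le]
    calc D {x | π.eval ω x ≠ g x} ≤ D ({x | π.eval ω x ≠ f x} ∪ {x | g x ≠ f x}) := by
          refine measure_mono fun x hx => ?_
          by_contra hcon
          simp only [Set.mem_union, Set.mem_ofPred_eq, not_or, not_not] at hcon
          exact hx (hcon.1.trans hcon.2.symm)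
      _ ≤ _ := (measure_union_le _ _).trans (add_le_add hf.le hgf.le)
  refine (measureReal_mono hsub (measure_ne_top _ _)).trans ((measureReal_biUnion_finset_le _ _).trans (le_trans ?_ hδ))
  refine (Finset.sum_le_sum fun g hg =>
    randomColoring_concentration D hc hκ0 hκ (hGm g hg) hη).trans (le_of_eq ?_)
  rw [Finset.sum_const, nsmul_eq_mul]

theorem gaussianReal_Ico_le (a b : ℝ) :
    gaussianReal 0 1 (Set.Ico a b) ≤ ENNReal.ofReal (b - a) := by
  rw [gaussianReal_apply 0 one_ne_zero]
  calc ∫⁻ x in Set.Ico a b, gaussianPDF 0 1 x ≤ ∫⁻ _ in Set.Ico a b, 1 := by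
        refine lintegral_mono fun x => ?_
        rw [gaussianPDF, ENNReal.ofReal_le_one, gaussianPDFReal]
        have h1 : (√(2 * Real.pi * (1 : NNReal)))⁻¹ ≤ 1 := by
          refine inv_le_one_of_one_le₀ (Real.one_le_sqrt.mpr ?_)
          rw [NNReal.coe_one]
          linarith [Real.pi_gt_three]
        have h2 : Real.exp (-(x - 0) ^ 2 / (2 * (1 : NNReal))) ≤ 1 := by
          rw [Real.exp_le_one_iff, NNReal.coe_one]
          nlinarith [sq_nonneg (x - 0)]
        exact mul_le_one₀ h1 (Real.exp_pos _).le h2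
    _ = ENNReal.ofReal (b - a) := by simp

/-- There are measurable partitions with all cells of small Gaussian mass. -/
theorem exists_fine_cell {n : ℕ} (hn : 0 < n) {κ : ℝ} (hκ : 0 < κ) :
    ∃ cell : EuclideanSpace ℝ (Fin n) → ℤ, Measurable cell ∧
      ∀ j, stdGaussian (EuclideanSpace ℝ (Fin n)) (cell ⁻¹' {j}) ≤ ENNReal.ofReal κ := by
  have hmp := measurePreserving_eval_multivariateGaussian
    (μ := (0 : EuclideanSpace ℝ (Fin n))) (Matrix.PosSemidef.one (n := Fin n) (R := ℝ)) (i := ⟨0, hn⟩)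
  simp only [multivariateGaussian_zero_one, PiLp.zero_apply, Matrix.one_apply_eq,
    Real.toNNReal_one] at hmp
  -- Slabs of width `κ` in the first coordinate; the one-dimensional Gaussian density is at most
  -- `1`.
  refine ⟨fun x => ⌊x ⟨0, hn⟩ / κ⌋, by fun_prop, fun j => ?_⟩
  have hset : (fun x : EuclideanSpace ℝ (Fin n) => ⌊x ⟨0, hn⟩ / κ⌋) ⁻¹' {j} =
      (fun x : EuclideanSpace ℝ (Fin n) => x ⟨0, hn⟩) ⁻¹' Set.Ico (j * κ) ((j + 1) * κ) := by
    ext x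
    simp only [Set.mem_preimage, Set.mem_singleton_iff, Int.floor_eq_iff, Set.mem_Ico,
      le_div_iff₀ hκ, div_lt_iff₀ hκ]
  rw [hset, hmp.measure_preimage measurableSet_Ico.nullMeasurableSet]
  refine (gaussianReal_Ico_le _ _).trans (le_of_eq ?_)
  congr 1
  ring

/-- Far random functions with uniform labels on points in distinct cells. -/
theorem exists_randomColoring_isFar {n : ℕ} (hn : 0 < n) {ε δ κ₀ : ℝ} (hε : 0 < ε) (hε' : ε < 1 / 2)
    (hδ : 0 < δ) (hκ₀ : 0 < κ₀) :
    ∃ (cell : EuclideanSpace ℝ (Fin n) → ℤ) (hc : Measurable cell),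
      (∀ j, stdGaussian (EuclideanSpace ℝ (Fin n)) (cell ⁻¹' {j}) ≤ ENNReal.ofReal κ₀) ∧
      (randomColoring cell hc).IsFar (stdGaussian (EuclideanSpace ℝ (Fin n))) (LTF n) ε δ := by
  -- The value for which `ε + η = 1/2 - η`. The net depends on `η` alone, so the cell mass `κ` can
  -- be chosen afterwards, small against the cardinality of the net.
  set η := (1 / 2 - ε) / 2 with hη
  have hη0 : 0 < η := by rw [hη]; linarith
  obtain ⟨G, hGm, hG⟩ := LTF_exists_finite_net n (ENNReal.ofReal_pos.mpr hη0)
  set κ := min κ₀ (δ * (4 * η ^ 2) / (G.card + 1)) with hκ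
  have hκpos : 0 < κ := lt_min hκ₀ (by positivity)
  obtain ⟨cell, hc, hcell⟩ := exists_fine_cell hn hκpos
  refine ⟨cell, hc, fun j => (hcell j).trans (ENNReal.ofReal_le_ofReal (min_le_left _ _)), ?_⟩
  refine randomColoring_isFar _ hc hκpos.le hcell hη0 hε (by rw [hη]; linarith) G hGm hG ?_
  have h1 : κ * (G.card + 1) ≤ δ * (4 * η ^ 2) := by
    rw [← le_div_iff₀ (by positivity)]; exact min_le_right _ _
  rw [← mul_div_assoc, div_le_iff₀ (by positivity)]
  nlinarith

/-- Samples from a measure with a fine partition rarely collide. -/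
theorem measure_not_injective_le {X : Type*} [MeasurableSpace X] (D : Measure X)
    [IsProbabilityMeasure D] {cell : X → ℤ} (hc : Measurable cell) {κ : ℝ≥0∞}
    (hκ : ∀ j, D (cell ⁻¹' {j}) ≤ κ) (u : ℕ) :
    Measure.pi (fun _ : Fin u => D) {S | ¬ Function.Injective fun i => cell (S i)} ≤ u ^ 2 * κ := by
  classical
  have hsub : {S : Fin u → X | ¬ Function.Injective fun i => cell (S i)} ⊆
      ⋃ p ∈ (Finset.univ : Finset (Fin u × Fin u)),
        if p.1 = p.2 then ∅ else {S : Fin u → X | cell (S p.1) = cell (S p.2)} := by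
    intro S hS
    simp only [Function.Injective, not_forall, Set.mem_ofPred_eq] at hS
    obtain ⟨i, j, hij, hne⟩ := hS
    refine Set.mem_iUnion₂.mpr ⟨(i, j), Finset.mem_univ _, ?_⟩
    simpa [hne] using hij
  refine (measure_mono hsub).trans ((measure_biUnion_finset_le _ _).trans ?_)
  calc _ ≤ ∑ _p : Fin u × Fin u, κ := ?_
    _ = u ^ 2 * κ := by simp [sq]
  refine Finset.sum_le_sum fun p _ => ?_
  split_ifs with h
  · simp
  have hind : iIndepFun (fun (i : Fin u) (S : Fin u → X) => S i) (Measure.pi fun _ => D) :=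
    iIndepFun_pi (X := fun _ x => x) fun _ => aemeasurable_id
  have h2 := (indepFun_iff_map_prod_eq_prod_map_map
    (measurable_pi_apply p.1).aemeasurable (measurable_pi_apply p.2).aemeasurable).mp (hind.indepFun h)
  rw [(measurePreserving_eval (fun _ : Fin u => D) p.1).map_eq,
    (measurePreserving_eval (fun _ : Fin u => D) p.2).map_eq] at h2
  have hms : MeasurableSet {z : X × X | cell z.1 = cell z.2} :=
    measurableSet_eq_fun (hc.comp measurable_fst) (hc.comp measurable_snd)
  refine le_trans (le_of_eq ?_) (prod_same_cell_le D hc hκ)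
  rw [← h2, Measure.map_apply (by fun_prop) hms]
  rfl

/-! ### Concentration of norms and near-orthogonality of samples -/

theorem integral_exp_mul_sq_gaussianReal {t : ℝ} (ht : t < 1 / 2) :
    ∫ x, Real.exp (t * x ^ 2) ∂(gaussianReal 0 1) = (√(1 - 2 * t))⁻¹ := by
  rw [integral_gaussianReal_eq_integral_smul one_ne_zero]
  have h1 : ∀ x : ℝ, gaussianPDFReal 0 1 x • Real.exp (t * x ^ 2) =
      (√(2 * Real.pi))⁻¹ * Real.exp (-(1 / 2 - t) * x ^ 2) := by
    intro x
    rw [gaussianPDFReal, NNReal.coe_one, mul_one, mul_one, smul_eq_mul, mul_assoc, ← Real.exp_add]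
    congr 2
    ring
  simp_rw [h1]
  rw [integral_const_mul, integral_gaussian, ← Real.sqrt_inv, ← Real.sqrt_inv,
    ← Real.sqrt_mul (by positivity)]
  congr 1
  have : (1 : ℝ) - 2 * t ≠ 0 := by linarith
  have : (1 : ℝ) / 2 - t ≠ 0 := by linarith
  have := Real.pi_ne_zero
  field_simp

/-- A non-integrable function has integral `0` by convention, whereas the computed value is
positive. -/
theorem integrable_exp_mul_sq_gaussianReal {t : ℝ} (ht : t < 1 / 2) :
    Integrable (fun x => Real.exp (t * x ^ 2)) (gaussianReal 0 1) := by
  by_contra h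
  have h1 := integral_exp_mul_sq_gaussianReal ht
  rw [integral_undef h] at h1
  have : 0 < (√(1 - 2 * t))⁻¹ := inv_pos.mpr (Real.sqrt_pos.mpr (by linarith))
  exact this.ne h1

theorem integral_exp_mul_norm_sq_stdGaussian (ι : Type*) [Fintype ι] {t : ℝ} (ht : t < 1 / 2) :
    Integrable (fun x => Real.exp (t * ‖x‖ ^ 2)) (stdGaussian (EuclideanSpace ℝ ι)) ∧
    ∫ x, Real.exp (t * ‖x‖ ^ 2) ∂(stdGaussian (EuclideanSpace ℝ ι)) =
      (√(1 - 2 * t))⁻¹ ^ Fintype.card ι := by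
  rw [← map_pi_eq_stdGaussian]
  have hm : AEMeasurable (WithLp.toLp 2 : (ι → ℝ) → EuclideanSpace ℝ ι)
    (Measure.pi fun _ => gaussianReal 0 1) := by fun_prop
  have h1 : ∀ x : ι → ℝ, Real.exp (t * ‖(WithLp.toLp 2 x : EuclideanSpace ℝ ι)‖ ^ 2) =
      ∏ i, Real.exp (t * x i ^ 2) := by
    intro x
    rw [EuclideanSpace.real_norm_sq_eq, Finset.mul_sum, Real.exp_sum]
  rw [integrable_map_measure (by fun_prop) hm, integral_map hm (by fun_prop)]
  simp only [Function.comp_def, h1]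
  refine ⟨Integrable.fintype_prod fun _ => integrable_exp_mul_sq_gaussianReal ht, ?_⟩
  rw [integral_fintype_prod_eq_prod (fun _ x => Real.exp (t * x ^ 2)),
    Finset.prod_const, Finset.card_univ, integral_exp_mul_sq_gaussianReal ht]

/-- Tails of the chi-squared distribution. -/
theorem stdGaussian_norm_sq_tail (ι : Type*) [Fintype ι] {δ : ℝ} (hδ : 0 < δ) (hδ1 : δ ≤ 1) :
    (stdGaussian (EuclideanSpace ℝ ι)).real {x | δ * Fintype.card ι < |‖x‖ ^ 2 - Fintype.card ι|} ≤
      2 * Real.exp (-(Fintype.card ι * δ ^ 2 / 8)) := by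
  set n := Fintype.card ι with hn
  set μ := stdGaussian (EuclideanSpace ℝ ι)
  -- With `s = 2t` the claim is `1 ≤ (1 - s) exp (s + s²)` for `|s| ≤ 1/2`. The quadratic Taylor
  -- bound for `exp` is needed for `s ≥ 0`; the linear one suffices for `s ≤ 0`.
  have hexp : ∀ t : ℝ, -(1 / 4) ≤ t → t ≤ 1 / 4 → (√(1 - 2 * t))⁻¹ ≤ Real.exp (t + 2 * t ^ 2) := by
    intro t ht0 ht
    rw [inv_le_comm₀ (Real.sqrt_pos.mpr (by linarith)) (Real.exp_pos _), ← Real.exp_neg]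
    refine Real.le_sqrt_of_sq_le ?_
    rw [← Real.exp_nat_mul]
    obtain ⟨s, rfl⟩ : ∃ s, t = s / 2 := ⟨2 * t, by ring⟩
    have h1 : Real.exp ((2 : ℕ) * -(s / 2 + 2 * (s / 2) ^ 2)) = (Real.exp (s + s ^ 2))⁻¹ := by
      rw [← Real.exp_neg]; congr 1; push_cast; ring
    rw [h1, inv_le_iff_one_le_mul₀ (Real.exp_pos _), show 1 - 2 * (s / 2) = 1 - s by ring]
    rcases le_total 0 s with hs | hs
    · have h0 := Real.quadratic_le_exp_of_nonneg (x := s + s ^ 2) (by positivity)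
      have h3 : 2 * s ≤ (1 - s) * (1 + s) ^ 2 := by nlinarith [mul_nonneg hs hs]
      have h4 : 1 ≤ (1 - s) * (1 + (s + s ^ 2) + (s + s ^ 2) ^ 2 / 2) := by
        nlinarith [mul_le_mul_of_nonneg_left h3 (sq_nonneg s)]
      exact h4.trans (mul_le_mul_of_nonneg_left h0 (by linarith))
    · have h0 := Real.add_one_le_exp (s + s ^ 2)
      have h4 : 1 ≤ (1 - s) * (s + s ^ 2 + 1) := by
        nlinarith [mul_nonneg (sq_nonneg s) (neg_nonneg.mpr hs)]
      exact h4.trans (mul_le_mul_of_nonneg_left h0 (by linarith))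
  have hcher : ∀ (t c : ℝ), -(1 / 4) ≤ t → t ≤ 1 / 4 →
      μ.real {x | c ≤ t * ‖x‖ ^ 2} ≤ Real.exp (n * (t + 2 * t ^ 2) - c) := by
    intro t c ht0 ht
    obtain ⟨hi, hI⟩ := integral_exp_mul_norm_sq_stdGaussian ι (t := t) (by linarith)
    have hM := mul_meas_ge_le_integral_of_nonneg (ae_of_all μ fun x => (Real.exp_pos (t * ‖x‖ ^ 2)).le)
      hi (Real.exp c)
    rw [hI] at hM
    have h2 : (√(1 - 2 * t))⁻¹ ^ n ≤ Real.exp (n * (t + 2 * t ^ 2)) := by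
      rw [Real.exp_nat_mul]
      exact pow_le_pow_left₀ (by positivity) (hexp t ht0 ht) n
    simp only [Real.exp_le_exp] at hM
    rw [Real.exp_sub, le_div_iff₀ (Real.exp_pos _), mul_comm]
    exact hM.trans h2
  have hn0 : (0 : ℝ) ≤ n := by positivity
  -- The Chernoff exponent per coordinate is `2t² - |t|δ` on either side, minimal at `t = ±δ/4` with
  -- value `-δ²/8`.
  have h1 := hcher (δ / 4) (δ / 4 * (n * (1 + δ))) (by linarith) (by linarith)
  have h2 := hcher (-(δ / 4)) (-(δ / 4) * (n * (1 - δ))) (by linarith) (by linarith)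
  have hsub : {x : EuclideanSpace ℝ ι | δ * n < |‖x‖ ^ 2 - n|} ⊆
      {x | δ / 4 * (n * (1 + δ)) ≤ δ / 4 * ‖x‖ ^ 2} ∪
        {x | -(δ / 4) * (n * (1 - δ)) ≤ -(δ / 4) * ‖x‖ ^ 2} := by
    intro x hx
    have hx' : δ * n < |‖x‖ ^ 2 - n| := hx
    rcases lt_abs.mp hx' with h | h
    · left
      change δ / 4 * (n * (1 + δ)) ≤ δ / 4 * ‖x‖ ^ 2
      gcongr
      linarith
    · right
      change -(δ / 4) * (n * (1 - δ)) ≤ -(δ / 4) * ‖x‖ ^ 2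
      nlinarith
  refine (measureReal_mono hsub).trans ((measureReal_union_le _ _).trans ?_)
  have e1 : n * (δ / 4 + 2 * (δ / 4) ^ 2) - δ / 4 * (n * (1 + δ)) = -(n * δ ^ 2 / 8) := by ring
  have e2 : n * (-(δ / 4) + 2 * (-(δ / 4)) ^ 2) - -(δ / 4) * (n * (1 - δ)) = -(n * δ ^ 2 / 8) := by ring
  rw [e1] at h1
  rw [e2] at h2
  linarith

/-- The law of a linear combination of independent standard Gaussian vectors. -/
theorem map_sum_smul_stdGaussian {E : Type*} [NormedAddCommGroup E]
    [InnerProductSpace ℝ E] [FiniteDimensional ℝ E] [MeasurableSpace E] [BorelSpace E]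
    {u : ℕ} (a : Fin u → ℝ) {c : ℝ} (hc : c ^ 2 = ∑ i, a i ^ 2) :
    (Measure.pi fun _ : Fin u => stdGaussian E).map (fun U => ∑ i, a i • U i) =
      (stdGaussian E).map (fun x => c • x) := by
  have hm1 : Measurable fun U : Fin u → E => ∑ i, a i • U i := by fun_prop
  have hm2 : Measurable fun x : E => c • x := by fun_prop
  have := Measure.isProbabilityMeasure_map (μ := Measure.pi fun _ : Fin u => stdGaussian E)
    hm1.aemeasurable
  have := Measure.isProbabilityMeasure_map (μ := stdGaussian E) hm2.aemeasurable
  refine Measure.ext_of_charFun (funext fun t => ?_)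
  rw [charFun_apply, charFun_apply, integral_map hm1.aemeasurable (by fun_prop),
    integral_map hm2.aemeasurable (by fun_prop)]
  have h1 : ∀ U : Fin u → E, Complex.exp (⟪∑ i, a i • U i, t⟫ * Complex.I) =
      ∏ i, Complex.exp (⟪U i, a i • t⟫ * Complex.I) := by
    intro U
    rw [← Complex.exp_sum, sum_inner, Complex.ofReal_sum, Finset.sum_mul]
    simp only [real_inner_smul_left, real_inner_smul_right]
  simp_rw [h1, real_inner_smul_left, ← real_inner_smul_right]
  rw [integral_fintype_prod_eq_prod (fun i x => Complex.exp (⟪x, a i • t⟫ * Complex.I))]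
  simp_rw [← charFun_apply, charFun_stdGaussian]
  rw [← Complex.exp_sum]
  have h2 : ∑ i, ‖a i • t‖ ^ 2 = ‖c • t‖ ^ 2 := by
    simp_rw [norm_smul, mul_pow, Real.norm_eq_abs, sq_abs]
    rw [← Finset.sum_mul, hc]
  rw [← Complex.ofReal_pow, ← h2, Complex.ofReal_sum, ← Finset.sum_div, Finset.sum_neg_distrib]
  simp only [Complex.ofReal_pow]

/-- Points of the unit ball are close to points of a grid. -/
theorem exists_grid_approx {ι : Type*} [Fintype ι] [Nonempty ι] (s : EuclideanSpace ℝ ι)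
    (hs : ‖s‖ = 1) : ∃ k : ι → ℤ, (∀ i, |k i| ≤ 2 * Fintype.card ι) ∧
      ‖s - (2 * Fintype.card ι : ℝ)⁻¹ • WithLp.toLp 2 (fun i => (k i : ℝ))‖ ≤ 1 / 4 := by
  set r : ℕ := Fintype.card ι with hr
  have hr1 : (1 : ℝ) ≤ r := by exact_mod_cast Fintype.card_pos
  have hR : (0 : ℝ) < 2 * r := by linarith
  -- Rounding to multiples of `1/(2r)` errs by at most `1/(4r)` in each of the `r` coordinates,
  -- hence by at most `1/4` in norm.
  refine ⟨fun i => round (2 * r * s i), fun i => ?_, ?_⟩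
  · have h1 := abs_sub_round (2 * (r : ℝ) * s i)
    have h2 : |2 * (r : ℝ) * s i| ≤ 2 * r := by
      rw [abs_mul, abs_of_pos hR]
      have : |s i| ≤ 1 := by
        rw [← Real.norm_eq_abs, ← hs]; exact PiLp.norm_apply_le s i
      nlinarith
    rw [abs_le] at h1 h2
    have h3 : ((round (2 * (r : ℝ) * s i) : ℤ) : ℝ) < (2 * r + 1 : ℤ) := by push_cast; linarith
    have h4 : ((-(2 * r + 1) : ℤ) : ℝ) < (round (2 * (r : ℝ) * s i) : ℤ) := by push_cast; linarith
    have h3' := Int.cast_lt.mp h3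
    have h4' := Int.cast_lt.mp h4
    change |round (2 * (r : ℝ) * s i)| ≤ _
    rw [abs_le]
    omega
  · refine abs_le_of_sq_le_sq' ?_ (by norm_num) |>.2
    rw [EuclideanSpace.real_norm_sq_eq]
    calc _ ≤ ∑ _i : ι, (1 / (4 * r) : ℝ) ^ 2 := by
          refine Finset.sum_le_sum fun i _ => ?_
          have h1 := abs_sub_round (2 * (r : ℝ) * s i)
          have h2 : (s - (2 * r : ℝ)⁻¹ • WithLp.toLp 2 (fun i => ((round (2 * (r : ℝ) * s i) : ℤ) : ℝ))) i =
              (2 * r : ℝ)⁻¹ * (2 * r * s i - round (2 * (r : ℝ) * s i)) := by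
            simp
            field_simp
          rw [h2]
          refine sq_le_sq' ?_ ?_ <;> rw [abs_le] at h1
          · rw [← sub_nonneg]
            have : (2 * r : ℝ)⁻¹ * (2 * r * s i - round (2 * (r : ℝ) * s i)) - -(1 / (4 * r)) =
              (2 * r : ℝ)⁻¹ * (2 * r * s i - round (2 * (r : ℝ) * s i) + 1 / 2) := by field_simp; ring
            rw [this]
            exact mul_nonneg (by positivity) (by linarith)
          · rw [← sub_nonneg]
            have : 1 / (4 * r) - (2 * r : ℝ)⁻¹ * (2 * r * s i - round (2 * (r : ℝ) * s i)) =
              (2 * r : ℝ)⁻¹ * (1 / 2 - (2 * r * s i - round (2 * (r : ℝ) * s i))) := by field_simp; ring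
            rw [this]
            exact mul_nonneg (by positivity) (by linarith)
      _ = r * (1 / (4 * r) : ℝ) ^ 2 := by simp [hr]
      _ ≤ (1 / 4) ^ 2 := by
          rw [div_pow, mul_pow, one_pow, ← mul_div_assoc, mul_one, div_le_iff₀ (by positivity)]
          nlinarith

/-- A quadratic form that is small on a grid is small everywhere. -/
theorem quadratic_le_of_grid {ι : Type*} [Fintype ι] [Nonempty ι] {E : Type*}
    [NormedAddCommGroup E] [InnerProductSpace ℝ E] [CompleteSpace E] (T : EuclideanSpace ℝ ι →L[ℝ] E) {N δ : ℝ}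
    (hN : 0 ≤ N) (hδ : 0 ≤ δ)
    (h : ∀ k : ι → ℤ, (∀ i, |k i| ≤ 2 * Fintype.card ι) →
      |‖T (WithLp.toLp 2 fun i => (k i : ℝ))‖ ^ 2 - N * ‖WithLp.toLp 2 fun i => (k i : ℝ)‖ ^ 2| ≤
        δ * N * ‖WithLp.toLp 2 fun i => (k i : ℝ)‖ ^ 2) (t : EuclideanSpace ℝ ι) :
    |‖T t‖ ^ 2 - N * ‖t‖ ^ 2| ≤ 4 * δ * N * ‖t‖ ^ 2 := by
  set B : EuclideanSpace ℝ ι →L[ℝ] EuclideanSpace ℝ ι :=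
    (ContinuousLinearMap.adjoint T).comp T - N • ContinuousLinearMap.id ℝ _ with hB
  have hBxy : ∀ x y, ⟪B x, y⟫ = ⟪T x, T y⟫ - N * ⟪x, y⟫ := fun x y => by
    simp [hB, inner_sub_left, ContinuousLinearMap.adjoint_inner_left, real_inner_smul_left]
  have hBsymm : ∀ x y, ⟪B x, y⟫ = ⟪B y, x⟫ := fun x y => by
    rw [hBxy, hBxy, real_inner_comm, real_inner_comm x y]
  have hQ : ∀ x, ⟪B x, x⟫ = ‖T x‖ ^ 2 - N * ‖x‖ ^ 2 := fun x => by
    rw [hBxy, real_inner_self_eq_norm_sq, real_inner_self_eq_norm_sq]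
  have hBle : ∀ x y, |⟪B x, y⟫| ≤ ‖B‖ * ‖x‖ * ‖y‖ := fun x y =>
    (abs_real_inner_le_norm _ _).trans (by gcongr; exact B.le_opNorm x)
  -- For a unit vector `s` and a grid point `v` within `1/4`, the form at `s` is the form at `v`
  -- plus `⟪B (s - v), s + v⟫`. Here `‖v‖² ≤ 25/16` and `‖s - v‖ ‖s + v‖ ≤ 9/16`. As `B` is
  -- symmetric, the supremum over `s` is `‖B‖`, so `‖B‖ ≤ K` absorbs into `‖B‖ ≤ (25/7) δN ≤ 4δN`.
  set K := 25 / 16 * (δ * N) + 9 / 16 * ‖B‖ with hK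
  have hK0 : 0 ≤ K := by positivity
  have hunit : ∀ s : EuclideanSpace ℝ ι, ‖s‖ = 1 → |⟪B s, s⟫| ≤ K := by
    intro s hs
    obtain ⟨k, hk, hks⟩ := exists_grid_approx s hs
    set c : ℝ := (2 * Fintype.card ι : ℝ)⁻¹
    set w : EuclideanSpace ℝ ι := WithLp.toLp 2 fun i => (k i : ℝ) with hw
    set v := c • w with hv
    have hQv : |⟪B v, v⟫| ≤ δ * N * ‖v‖ ^ 2 := by
      have h1 : ⟪B v, v⟫ = c ^ 2 * ⟪B w, w⟫ := by
        rw [hv, map_smul, real_inner_smul_left, real_inner_smul_right]; ring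
      rw [h1, abs_mul, abs_of_nonneg (sq_nonneg c), hQ, hv, norm_smul, mul_pow, Real.norm_eq_abs, sq_abs]
      have := mul_le_mul_of_nonneg_left (h k hk) (sq_nonneg c)
      linarith
    have hvn : ‖v‖ ≤ 5 / 4 := by
      have := norm_sub_norm_le v s
      rw [norm_sub_rev] at this
      linarith
    have hsplit : ⟪B s, s⟫ = ⟪B v, v⟫ + ⟪B (s - v), s + v⟫ := by
      rw [map_sub, inner_sub_left, inner_add_right, inner_add_right, hBsymm v s]
      ring
    have h2 : |⟪B (s - v), s + v⟫| ≤ 9 / 16 * ‖B‖ := by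
      refine (hBle _ _).trans ?_
      have h3 : ‖s + v‖ ≤ 9 / 4 := (norm_add_le _ _).trans (by linarith)
      have h4 : ‖s - v‖ * ‖s + v‖ ≤ 1 / 4 * (9 / 4) := by gcongr
      have := mul_le_mul_of_nonneg_left h4 (norm_nonneg B)
      linarith
    have h5 : δ * N * ‖v‖ ^ 2 ≤ 25 / 16 * (δ * N) := by
      have : ‖v‖ ^ 2 ≤ (5 / 4) ^ 2 := by gcongr
      have := mul_le_mul_of_nonneg_left this (mul_nonneg hδ hN)
      linarith
    rw [hsplit]
    exact (abs_add_le _ _).trans (by linarith)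
  have hall : ∀ x, |B.rayleighQuotient x| ≤ K := by
    intro x
    by_cases hx : x = 0
    · simpa [hx] using hK0
    · have hx0 : ‖x‖ ≠ 0 := norm_ne_zero_iff.mpr hx
      have h1 := hunit (‖x‖⁻¹ • x) (by simp [norm_smul, hx0])
      rw [map_smul, real_inner_smul_left, real_inner_smul_right] at h1
      have h2 : B.rayleighQuotient x = ‖x‖⁻¹ * (‖x‖⁻¹ * ⟪B x, x⟫) := by
        rw [ContinuousLinearMap.rayleighQuotient, ContinuousLinearMap.reApplyInnerSelf_apply]
        simp only [RCLike.re_to_real]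
        field_simp
      rwa [h2]
  have hBK : ‖B‖ ≤ K := by
    have hs : (B : EuclideanSpace ℝ ι →ₗ[ℝ] EuclideanSpace ℝ ι).IsSymmetric := fun x y => by
      change ⟪B x, y⟫ = ⟪x, B y⟫
      rw [hBsymm, real_inner_comm]
    rw [ContinuousLinearMap.norm_eq_iSup_rayleighQuotient B hs]
    exact ciSup_le hall
  rw [← hQ]
  refine (hBle t t).trans ?_
  have h6 : ‖B‖ ≤ 4 * δ * N := by
    have : 0 ≤ δ * N := mul_nonneg hδ hN
    linarith
  calc ‖B‖ * ‖t‖ * ‖t‖ = ‖B‖ * ‖t‖ ^ 2 := by ring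
    _ ≤ _ := by gcongr

/-- A fixed linear combination of Gaussian samples has about the expected length. -/
theorem measure_sum_smul_tail {n u : ℕ} (a : Fin u → ℝ) {δ : ℝ} (hδ : 0 < δ) (hδ1 : δ ≤ 1) :
    (Measure.pi fun _ : Fin u => stdGaussian (EuclideanSpace ℝ (Fin n))).real
      {U | δ * n * ∑ i, a i ^ 2 < |‖∑ i, a i • U i‖ ^ 2 - n * ∑ i, a i ^ 2|} ≤
      2 * Real.exp (-(n * δ ^ 2 / 8)) := by
  set c := √(∑ i, a i ^ 2) with hc
  have hc2 : c ^ 2 = ∑ i, a i ^ 2 := Real.sq_sqrt (Finset.sum_nonneg fun i _ => sq_nonneg _)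
  rw [← hc2]
  have hm1 : Measurable fun U : Fin u → EuclideanSpace ℝ (Fin n) => ∑ i, a i • U i := by fun_prop
  have hm2 : Measurable fun x : EuclideanSpace ℝ (Fin n) => c • x := by fun_prop
  have hms : MeasurableSet {x : EuclideanSpace ℝ (Fin n) | δ * n * c ^ 2 < |‖x‖ ^ 2 - n * c ^ 2|} :=
    (isOpen_lt continuous_const (by fun_prop)).measurableSet
  have htail := stdGaussian_norm_sq_tail (Fin n) hδ hδ1
  rw [Fintype.card_fin] at htail
  have h1 : (Measure.pi fun _ : Fin u => stdGaussian (EuclideanSpace ℝ (Fin n))).real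
      {U | δ * n * c ^ 2 < |‖∑ i, a i • U i‖ ^ 2 - n * c ^ 2|} =
      (stdGaussian (EuclideanSpace ℝ (Fin n))).real
        {x | δ * n * c ^ 2 < |‖c • x‖ ^ 2 - n * c ^ 2|} := by
    have h2 := map_sum_smul_stdGaussian (E := EuclideanSpace ℝ (Fin n)) a hc2
    have h3 := congrArg (fun μ => μ.real
      {x : EuclideanSpace ℝ (Fin n) | δ * n * c ^ 2 < |‖x‖ ^ 2 - n * c ^ 2|}) h2
    simp only [map_measureReal_apply hm1 hms, map_measureReal_apply hm2 hms] at h3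
    exact h3
  rw [h1]
  refine (measureReal_mono fun x hx => ?_).trans htail
  have hx' : δ * n * c ^ 2 < |‖c • x‖ ^ 2 - n * c ^ 2| := hx
  change δ * n < |‖x‖ ^ 2 - n|
  rw [norm_smul, mul_pow, Real.norm_eq_abs, sq_abs, mul_comm (n : ℝ) (c ^ 2), ← mul_sub, abs_mul,
    abs_of_nonneg (sq_nonneg c), mul_comm] at hx'
  exact lt_of_mul_lt_mul_left hx' (sq_nonneg c)

/-- The samples indexed by `A` are not nearly orthogonal. -/
def notNearIsometry {n u : ℕ} (A : Finset (Fin u)) (δ : ℝ) : Set (Fin u → EuclideanSpace ℝ (Fin n)) :=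
  {U | ∃ t : EuclideanSpace ℝ A, δ * n * ‖t‖ ^ 2 < |‖∑ i, t i • U i‖ ^ 2 - n * ‖t‖ ^ 2|}

/-- Union bound over the `(4|A| + 1)^|A|` integer coefficient vectors with entries at most `2|A|` in
absolute value. Passing from the grid to all coefficients costs the factor `4` in the distortion. -/
theorem measure_notNearIsometry_le {n u : ℕ} (A : Finset (Fin u)) {δ : ℝ} (hδ : 0 < δ) (hδ1 : δ ≤ 1) :
    (Measure.pi fun _ : Fin u => stdGaussian (EuclideanSpace ℝ (Fin n))).real
      (notNearIsometry A (4 * δ)) ≤ (4 * A.card + 1) ^ A.card * (2 * Real.exp (-(n * δ ^ 2 / 8))) := by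
  classical
  rcases A.eq_empty_or_nonempty with rfl | hA
  · have : notNearIsometry (n := n) (∅ : Finset (Fin u)) (4 * δ) = ∅ := by
      ext U
      simp only [notNearIsometry, Set.mem_ofPred_eq, Set.mem_empty_iff_false, iff_false, not_exists]
      intro t
      rw [Subsingleton.elim t 0]
      simp
    rw [this, measureReal_empty]
    positivity
  have : Nonempty A := hA.to_subtype
  have hcard : Fintype.card A = A.card := Fintype.card_coe A
  let K : Finset (A → ℤ) := Fintype.piFinset fun _ => Finset.Icc (-(2 * A.card : ℤ)) (2 * A.card)
  let a : (A → ℤ) → Fin u → ℝ := fun k i => if h : i ∈ A then (k ⟨i, h⟩ : ℝ) else 0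
  have ha1 : ∀ (k : A → ℤ) (U : Fin u → EuclideanSpace ℝ (Fin n)),
      ∑ i : A, (k i : ℝ) • U i = ∑ i, a k i • U i := by
    intro k U
    rw [← Finset.sum_subset (Finset.subset_univ A) (fun i _ hi => by simp [a, hi]), ← Finset.sum_coe_sort A]
    refine Finset.sum_congr rfl fun i _ => by simp [a]
  have ha2 : ∀ k : A → ℤ, ‖(WithLp.toLp 2 fun i => (k i : ℝ) : EuclideanSpace ℝ A)‖ ^ 2 =
      ∑ i, a k i ^ 2 := by
    intro k
    rw [EuclideanSpace.real_norm_sq_eq,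
      ← Finset.sum_subset (Finset.subset_univ A) (fun i _ hi => by simp [a, hi]), ← Finset.sum_coe_sort A]
    refine Finset.sum_congr rfl fun i _ => by simp [a]
  have hsub : notNearIsometry (n := n) A (4 * δ) ⊆
      ⋃ k ∈ K, {U | δ * n * ∑ i, a k i ^ 2 < |‖∑ i, a k i • U i‖ ^ 2 - n * ∑ i, a k i ^ 2|} := by
    intro U hU
    by_contra hcon
    simp only [Set.mem_iUnion, Set.mem_ofPred_eq, not_exists, not_lt] at hcon
    obtain ⟨t, ht⟩ := hU
    let T : EuclideanSpace ℝ A →L[ℝ] EuclideanSpace ℝ (Fin n) :=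
      ∑ i : A, (EuclideanSpace.proj i).smulRight (U i)
    have hT : ∀ t, T t = ∑ i : A, t i • U i := fun t => by simp [T]
    have := quadratic_le_of_grid T (N := n) (δ := δ) (by positivity) hδ.le (fun k hk => by
      have h1 := hcon k (by
        rw [Fintype.mem_piFinset]
        intro i
        have := hk i
        rw [hcard, abs_le] at this
        exact Finset.mem_Icc.mpr this)
      rw [hT, ha2, ha1]
      exact h1) t
    rw [hT] at this
    exact absurd ht this.not_gt
  refine (measureReal_mono hsub (measure_ne_top _ _)).trans ((measureReal_biUnion_finset_le _ _).trans ?_)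
  refine (Finset.sum_le_sum fun k _ => measure_sum_smul_tail (a k) hδ hδ1).trans (le_of_eq ?_)
  rw [Finset.sum_const, nsmul_eq_mul]
  congr 1
  have : K.card = (4 * A.card + 1) ^ A.card := by
    rw [show K = Fintype.piFinset fun _ => Finset.Icc (-(2 * A.card : ℤ)) (2 * A.card) from rfl,
      Fintype.card_piFinset, Finset.prod_const, Finset.card_univ, Int.card_Icc, hcard]
    congr 1
    omega
  rw [this]
  push_cast
  rfl

/-- With high probability all small sets of samples are nearly orthogonal. -/
theorem measure_exists_notNearIsometry_le {n u q : ℕ} {δ : ℝ} (hδ : 0 < δ) (hδ1 : δ ≤ 1) :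
    (Measure.pi fun _ : Fin u => stdGaussian (EuclideanSpace ℝ (Fin n))).real
      {U | ∃ A : Finset (Fin u), A.card ≤ q ∧ U ∈ notNearIsometry A (4 * δ)} ≤
      (u * (4 * q + 1)) ^ q * (2 * Real.exp (-(n * δ ^ 2 / 8))) := by
  classical
  -- A nonempty set of at most `q` indices is the image of a map from `Fin q`, which gives the count
  -- `u ^ q`. The empty set never fails to be nearly isometric.
  have hsub : {U : Fin u → EuclideanSpace ℝ (Fin n) |
      ∃ A : Finset (Fin u), A.card ≤ q ∧ U ∈ notNearIsometry A (4 * δ)} ⊆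
      ⋃ f ∈ (Finset.univ : Finset (Fin q → Fin u)),
        notNearIsometry (Finset.univ.image f) (4 * δ) := by
    rintro U ⟨A, hA, hU⟩
    rcases A.eq_empty_or_nonempty with rfl | ⟨a, ha⟩
    · obtain ⟨t, ht⟩ := hU
      rw [Subsingleton.elim t 0] at ht
      simp at ht
    · obtain ⟨e⟩ : Nonempty (A ↪ Fin q) := by
        rw [Function.Embedding.nonempty_iff_card_le]; simpa using hA
      have : Nonempty A := ⟨⟨a, ha⟩⟩
      refine Set.mem_iUnion₂.mpr ⟨fun j => (Function.invFun e j : A), Finset.mem_univ _, ?_⟩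
      convert hU
      ext i
      simp only [Finset.mem_image, Finset.mem_univ, true_and]
      constructor
      · rintro ⟨j, rfl⟩
        exact Subtype.coe_prop _
      · intro hi
        exact ⟨e ⟨i, hi⟩, by rw [Function.leftInverse_invFun e.injective]⟩
  refine (measureReal_mono hsub (measure_ne_top _ _)).trans ((measureReal_biUnion_finset_le _ _).trans ?_)
  calc _ ≤ ∑ _f : Fin q → Fin u, ((4 * q + 1 : ℝ) ^ q * (2 * Real.exp (-(n * δ ^ 2 / 8)))) := by
        refine Finset.sum_le_sum fun f _ => (measure_notNearIsometry_le _ hδ hδ1).trans ?_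
        have hle : (Finset.univ.image f).card ≤ q := Finset.card_image_le.trans (by simp)
        have hle' : ((Finset.univ.image f).card : ℝ) ≤ q := by exact_mod_cast hle
        gcongr
        · calc _ ≤ (4 * q + 1 : ℝ) ^ (Finset.univ.image f).card := by gcongr
            _ ≤ _ := pow_le_pow_right₀ (by linarith [(Nat.cast_nonneg q : (0 : ℝ) ≤ q)]) hle
    _ = _ := by
        simp [mul_pow]
        ring

/-! ### Label distributions and decision trees -/

namespace RandomFunction

variable {X : Type*} [MeasurableSpace X]

theorem measurable_eval_apply (π : RandomFunction X) (x : X) : Measurable fun ω => π.eval ω x :=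
  π.measurable_eval.comp (measurable_id.prodMk measurable_const)

theorem sum_labelProb (π : RandomFunction X) {u : ℕ} (U : Fin u → X) (p : (Fin u → Bool) → Prop)
    [DecidablePred p] :
    ∑ y, (if p y then π.labelProb U y else 0) = π.μ.real {ω | p fun i => π.eval ω (U i)} := by
  classical
  have h1 : ∀ y : Fin u → Bool, {ω | ∀ i, π.eval ω (U i) = y i} =
      (fun ω i => π.eval ω (U i)) ⁻¹' {y} := by
    intro y; ext ω; simp [funext_iff]
  have hm : Measurable fun ω (i : Fin u) => π.eval ω (U i) :=
    measurable_pi_lambda _ fun i => π.measurable_eval_apply (U i)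
  have h2 : {ω | p fun i => π.eval ω (U i)} =
      ⋃ y ∈ Finset.univ.filter p, (fun ω i => π.eval ω (U i)) ⁻¹' {y} := by
    ext ω; simp
  rw [h2, measureReal_biUnion_finset, Finset.sum_filter]
  · simp only [labelProb, h1]
  · intro y _ y' _ hne
    exact Disjoint.preimage _ (Set.disjoint_singleton.mpr hne)
  · exact fun y _ => hm (measurableSet_singleton y)

theorem sum_labelProb_eq_one (π : RandomFunction X) {u : ℕ} (U : Fin u → X) :
    ∑ y, π.labelProb U y = 1 := by
  have := π.sum_labelProb U fun _ => True
  simpa using this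

theorem err_fair (π π' : RandomFunction X) {u : ℕ} (U : Fin u → X) (h : (Fin u → Bool) → Bool) :
    err h (π.fair π' U) = (1 / 2) * (1 - ∑ y, (if h y = true then π.labelProb U y else 0) +
      ∑ y, (if h y = true then π'.labelProb U y else 0)) := by
  have key : err h (π.fair π' U) = (1 / 2) * (∑ y, π.labelProb U y -
      ∑ y, (if h y = true then π.labelProb U y else 0) +
      ∑ y, (if h y = true then π'.labelProb U y else 0)) := by
    rw [← Finset.sum_sub_distrib, ← Finset.sum_add_distrib, Finset.mul_sum, err, Fintype.sum_prod_type]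
    refine Finset.sum_congr rfl fun y _ => ?_
    rw [Fintype.sum_bool]
    cases hy : h y <;> simp [fair]
  rw [key, π.sum_labelProb_eq_one U]

end RandomFunction

/-- If one distribution dominates another on small cylinders, so it does on the accepting set of a
shallow decision tree. -/
theorem DecisionTree.sum_run_le {u q : ℕ} {p p' : (Fin u → Bool) → ℝ} {C : ℝ}
    (h : ∀ A : Finset (Fin u), A.card ≤ q → ∀ a : Fin u → Bool,
      ∑ y, (if ∀ i ∈ A, y i = a i then p y else 0) ≤ C * ∑ y, (if ∀ i ∈ A, y i = a i then p' y else 0))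
    (T : DecisionTree u) : ∀ (A : Finset (Fin u)) (a : Fin u → Bool), T.depth + A.card ≤ q →
      ∑ y, (if (∀ i ∈ A, y i = a i) ∧ T.run y = true then p y else 0) ≤
        C * ∑ y, (if (∀ i ∈ A, y i = a i) ∧ T.run y = true then p' y else 0) := by
  induction T with
  | leaf b =>
    intro A a hA
    cases b
    · simp [DecisionTree.run]
    · simpa [DecisionTree.run] using h A (by omega) a
  | query j s t ihs iht =>
    intro A a hA
    rw [DecisionTree.depth] at hA
    have hcard : (insert j A).card ≤ A.card + 1 := Finset.card_insert_le _ _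
    -- The pair `(A, a)` records the answers seen on the way down. Querying a recorded index leads
    -- to a determined branch; a new index splits the cylinder in two, trading one unit of depth for
    -- one of cardinality.
    by_cases hj : j ∈ A
    · have hrun : ∀ y : Fin u → Bool, ((∀ i ∈ A, y i = a i) ∧ (query j s t).run y = true) ↔
          ((∀ i ∈ A, y i = a i) ∧ (if a j = true then t else s).run y = true) := by
        intro y
        refine and_congr_right fun hy => ?_
        rw [DecisionTree.run, hy j hj]
        split_ifs <;> rfl
      simp only [hrun]
      split_ifs
      · exact iht A a (by omega)
      · exact ihs A a (by omega)
    · have hsplit : ∀ r : (Fin u → Bool) → ℝ,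
          ∑ y, (if (∀ i ∈ A, y i = a i) ∧ (query j s t).run y = true then r y else 0) =
          ∑ y, (if (∀ i ∈ insert j A, y i = Function.update a j true i) ∧ t.run y = true then r y else 0) +
          ∑ y, (if (∀ i ∈ insert j A, y i = Function.update a j false i) ∧ s.run y = true then r y else 0) := by
        intro r
        rw [← Finset.sum_add_distrib]
        refine Finset.sum_congr rfl fun y _ => ?_
        have hagree : ∀ b, (∀ i ∈ insert j A, y i = Function.update a j b i) ↔
            (y j = b ∧ ∀ i ∈ A, y i = a i) := by
          intro b
          rw [Finset.forall_mem_insert, Function.update_self]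
          refine and_congr_right fun _ => forall₂_congr fun i hi => ?_
          rw [Function.update_of_ne (ne_of_mem_of_not_mem hi hj)]
        simp only [hagree, DecisionTree.run]
        by_cases hyj : y j = true <;> simp [hyj]
      rw [hsplit p, hsplit p', mul_add]
      exact add_le_add (iht _ _ (by omega)) (ihs _ _ (by omega))

/-- Shallow decision trees do not distinguish distributions that are close on small cylinders. -/
theorem errStar_fair_ge {X : Type*} [MeasurableSpace X] (π π' : RandomFunction X) {u q : ℕ}
    (U : Fin u → X)
    (h : ∀ A : Finset (Fin u), A.card ≤ q → ∀ a : Fin u → Bool,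
      π.μ.real {ω | ∀ i ∈ A, π.eval ω (U i) = a i} ≤
        2 * π'.μ.real {ω | ∀ i ∈ A, π'.eval ω (U i) = a i}) :
    1 / 4 ≤ errStar (DT u q) (π.fair π' U) := by
  have : Nonempty (DT u q) := ⟨⟨_, DecisionTree.leaf true, Nat.zero_le _, rfl⟩⟩
  refine le_ciInf fun ⟨f, T, hT, hf⟩ => ?_
  subst hf
  change 1 / 4 ≤ err T.run _
  rw [RandomFunction.err_fair]
  have h1 := T.sum_run_le (p := π.labelProb U) (p' := π'.labelProb U) (C := 2) (q := q)
    (fun A hA a => by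
      rw [π.sum_labelProb U (fun y => ∀ i ∈ A, y i = a i),
        π'.sum_labelProb U (fun y => ∀ i ∈ A, y i = a i)]
      exact h A hA a) ∅ (fun _ => true) (by simpa using hT)
  simp only [Finset.notMem_empty, false_implies, implies_true, true_and] at h1
  have h2 : ∑ y, (if T.run y = true then π.labelProb U y else 0) ≤ 1 := by
    rw [π.sum_labelProb U (fun y => T.run y = true)]
    exact measureReal_le_one
  -- With acceptance probabilities `p ≤ 2p'` and `p ≤ 1`, the error is `(1 - p + p') / 2 ≥ (1 - p/2)
  -- / 2 ≥ 1/4`; no reverse comparison is needed.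
  linarith

/-! ### Active testing: Gaussian normal vectors -/

theorem measurable_uncurry_halfspace_zero {n : ℕ} :
    Measurable (Function.uncurry fun w : EuclideanSpace ℝ (Fin n) => halfspace (w, 0)) := by
  refine measurable_to_bool ?_
  have : (Function.uncurry fun w : EuclideanSpace ℝ (Fin n) => halfspace (w, 0)) ⁻¹' {true} =
      {z | 0 ≤ ⟪z.1, z.2⟫} := by
    ext z
    simp [halfspace, Function.uncurry]
  rw [this]
  exact (isClosed_le continuous_const (by fun_prop)).measurableSet

/-- A random homogeneous halfspace. -/
noncomputable def gaussianHalfspace (n : ℕ) : RandomFunction (EuclideanSpace ℝ (Fin n)) where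
  Ω := EuclideanSpace ℝ (Fin n)
  μ := stdGaussian _
  eval w := halfspace (w, 0)
  measurable_eval := measurable_uncurry_halfspace_zero

theorem gaussianHalfspace_isOver (n : ℕ) : (gaussianHalfspace n).IsOver (LTF n) :=
  ae_of_all _ fun w => halfspace_mem_LTF (w, 0)

/-- Turns relative distortion `δ` of squared norms into a bound on the ratio `l / m` of
`stdGaussian_signs_le`. -/
theorem sqrt_ratio_le {δ N : ℝ} (hδ0 : 0 ≤ δ) (hδ : δ ≤ 1 / 2) (hN : 0 < N) :
    √((1 + δ) * N) / √((1 - δ) * N) ≤ 1 + 2 * δ := by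
  have h1 : 0 < (1 - δ) * N := mul_pos (by linarith) hN
  rw [div_le_iff₀ (Real.sqrt_pos.mpr h1), Real.sqrt_le_left (by positivity), mul_pow,
    Real.sq_sqrt h1.le, ← mul_assoc]
  refine mul_le_mul_of_nonneg_right ?_ hN.le
  nlinarith [mul_nonneg hδ0 (sub_nonneg.mpr hδ), mul_nonneg hδ0 (mul_nonneg hδ0 (sub_nonneg.mpr hδ))]

/-- Nearly orthogonal samples are labelled nearly uniformly by a random halfspace. -/
theorem gaussianHalfspace_cylinder_le {n u q : ℕ} (hn : 0 < n) (hq : 0 < q)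
    {U : Fin u → EuclideanSpace ℝ (Fin n)} {A : Finset (Fin u)} (hA : A.card ≤ q)
    (hU : U ∉ notNearIsometry A (1 / (4 * q))) (a : Fin u → Bool) :
    (gaussianHalfspace n).μ.real {ω | ∀ i ∈ A, (gaussianHalfspace n).eval ω (U i) = a i} ≤
      2 * (2⁻¹ : ℝ) ^ A.card := by
  set δ : ℝ := 1 / (4 * q) with hδ
  have hq1 : (1 : ℝ) ≤ q := by exact_mod_cast hq
  have hn0 : (0 : ℝ) < n := by exact_mod_cast hn
  have hδ0 : 0 < δ := by positivity
  have hδ1 : δ ≤ 1 / 4 := by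
    rw [hδ]
    exact one_div_le_one_div_of_le (by norm_num) (by linarith)
  have hU' : ∀ t : EuclideanSpace ℝ A, |‖∑ i, t i • U i‖ ^ 2 - n * ‖t‖ ^ 2| ≤ δ * n * ‖t‖ ^ 2 := by
    intro t
    by_contra hcon
    exact hU ⟨t, not_le.mp hcon⟩
  have h1 : 0 < (1 - δ) * n := mul_pos (by linarith) hn0
  have h2 : 0 < (1 + δ) * n := mul_pos (by linarith) hn0
  have hmain := stdGaussian_signs_le (fun i : A => U i) (Real.sqrt_pos.mpr h1) (Real.sqrt_pos.mpr h2)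
    (fun t => by
      refine abs_le_of_sq_le_sq' ?_ (norm_nonneg _) |>.2
      rw [mul_pow, Real.sq_sqrt h1.le]
      have := (abs_le.mp (hU' t)).1
      linarith)
    (fun t => by
      refine abs_le_of_sq_le_sq' ?_ (by positivity) |>.2
      rw [mul_pow, Real.sq_sqrt h2.le]
      have := (abs_le.mp (hU' t)).2
      linarith) (fun i => a i)
  have hset : {w : EuclideanSpace ℝ (Fin n) | ∀ i ∈ A, halfspace (w, 0) (U i) = a i} =
      {w | ∀ i : A, (0 ≤ ⟪U i, w⟫ ↔ a i = true)} := by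
    ext w
    simp only [Set.mem_ofPred_eq, Subtype.forall]
    refine forall₂_congr fun i _ => ?_
    rw [halfspace, Bool.eq_iff_iff, decide_eq_true_eq, sub_zero, real_inner_comm]
  change (stdGaussian (EuclideanSpace ℝ (Fin n))).real
    {w : EuclideanSpace ℝ (Fin n) | ∀ i ∈ A, halfspace (w, 0) (U i) = a i} ≤ _
  rw [hset]
  refine hmain.trans ?_
  rw [Fintype.card_coe, div_eq_mul_inv, ← inv_pow]
  refine mul_le_mul_of_nonneg_right ?_ (by positivity)
  -- With `δ = 1/(4q)` the `q`-fold product of ratios is at most `exp (1/2)`, which is below `2`.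
  calc _ ≤ (1 + 2 * δ) ^ A.card := by
        gcongr
        exact sqrt_ratio_le hδ0.le (by linarith) hn0
    _ ≤ (1 + 2 * δ) ^ q := pow_le_pow_right₀ (by linarith) hA
    _ ≤ Real.exp (2 * δ) ^ q := by
        gcongr
        linarith [Real.add_one_le_exp (2 * δ)]
    _ = Real.exp (1 / 2) := by
        rw [← Real.exp_nat_mul]
        congr 1
        rw [hδ]
        field_simp
        norm_num
    _ ≤ 2 := by
        have h3 := Real.exp_one_lt_three
        have h4 : Real.exp (1 / 2) ^ 2 = Real.exp 1 := by
          rw [← Real.exp_nat_mul]; norm_num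
        nlinarith [Real.exp_pos (1 / 2)]

/-- The active testing dimension of halfspaces is at least `q` when `q² · q log(uq)` is at most
about `n`. -/
theorem le_activeDim_LTF {n u q : ℕ} (hn : 0 < n) (hq : 0 < q) {ε δ : ℝ} (hε : 0 < ε)
    (hε' : ε < 1 / 2) (hδ : 0 < δ)
    (h : (u * (4 * q + 1) : ℝ) ^ q * (2 * Real.exp (-(n * (1 / (16 * q)) ^ 2 / 8))) ≤ 1 / 8) :
    (q : ℕ∞) ≤ activeDim (LTF n) (stdGaussian (EuclideanSpace ℝ (Fin n))) u ε δ := by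
  -- This cell mass makes collisions among the `u` points have probability at most `1/8`, leaving
  -- `1/8` for the failure of near-orthogonality.
  obtain ⟨cell, hc, hcell, hfar⟩ := exists_randomColoring_isFar hn hε hε' hδ
    (κ₀ := 1 / (8 * (u ^ 2 + 1))) (by positivity)
  refine le_iSup₂_of_le q ⟨gaussianHalfspace n, randomColoring cell hc,
    gaussianHalfspace_isOver n, hfar, ?_⟩ le_rfl
  have hq1 : (1 : ℝ) ≤ q := by exact_mod_cast hq
  have hsub : {U : Fin u → EuclideanSpace ℝ (Fin n) | errStar (DT u q)
      ((gaussianHalfspace n).fair (randomColoring cell hc) U) < 1 / 4} ⊆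
      {U | ¬ Function.Injective fun i => cell (U i)} ∪
      {U | ∃ A : Finset (Fin u), A.card ≤ q ∧ U ∈ notNearIsometry A (4 * (1 / (16 * q)))} := by
    intro U hU
    by_contra hcon
    simp only [Set.mem_union, Set.mem_ofPred_eq, not_or, not_not, not_exists, not_and] at hcon hU
    refine absurd hU (not_lt.mpr (errStar_fair_ge _ _ U fun A hA a => ?_))
    rw [randomColoring_cylinder cell hc U A hcon.1.injOn]
    refine gaussianHalfspace_cylinder_le hn hq hA ?_ a
    have := hcon.2 A hA
    rwa [show 4 * (1 / (16 * (q : ℝ))) = 1 / (4 * q) by field_simp; norm_num] at this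
  have h2 := measure_exists_notNearIsometry_le (n := n) (u := u) (q := q) (δ := 1 / (16 * q))
    (by positivity) (by rw [div_le_one (by positivity)]; linarith)
  have h3 := measure_not_injective_le (stdGaussian (EuclideanSpace ℝ (Fin n))) hc hcell u
  have h4 : ((u : ℝ≥0∞) ^ 2 * ENNReal.ofReal (1 / (8 * (u ^ 2 + 1)))) ≤ ENNReal.ofReal (1 / 8) := by
    rw [← ENNReal.ofReal_natCast, ← ENNReal.ofReal_pow (by positivity), ← ENNReal.ofReal_mul (by positivity)]
    refine ENNReal.ofReal_le_ofReal ?_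
    rw [mul_one_div, div_le_div_iff₀ (by positivity) (by norm_num)]
    nlinarith [sq_nonneg (u : ℝ)]
  have h5 := ENNReal.ofReal_le_ofReal (h2.trans h)
  rw [ofReal_measureReal] at h5
  refine (measure_mono hsub).trans ((measure_union_le _ _).trans
    ((add_le_add (h3.trans h4) h5).trans ?_))
  rw [← ENNReal.ofReal_add (by norm_num) (by norm_num)]
  refine le_trans (ENNReal.ofReal_le_ofReal (q := 4⁻¹) (by norm_num)) ?_
  rw [ENNReal.ofReal_inv_of_pos (by norm_num), ENNReal.ofReal_ofNat, one_div]

/-! ### Passive testing: sign normal vectors and the second moment -/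

/-- Halfspaces with correlation `ρ` between their normal vectors agree on at most about half of the
space. -/
theorem stdGaussian_agree_le {n : ℕ} {a b : EuclideanSpace ℝ (Fin n)} {N ρ : ℝ} (hN : 0 < N)
    (hρ : 0 ≤ ρ) (ha : ‖a‖ ^ 2 = N) (hb : ‖b‖ ^ 2 = N) (hab : |⟪a, b⟫| ≤ ρ * N) :
    (stdGaussian (EuclideanSpace ℝ (Fin n))).real {x | halfspace (a, 0) x = halfspace (b, 0) x} ≤
      (1 + 6 * ρ) / 2 := by
  -- Agreement means one of two constant sign patterns, each of probability at most `(1 + 2ρ)²/4`.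
  -- The sum `(1 + 2ρ)²/2` is at most `(1 + 6ρ)/2` exactly when `ρ ≤ 1/2` (or `ρ = 0`); for larger
  -- `ρ` the claim is trivial.
  rcases lt_or_ge (1 / 2) ρ with h | h
  · exact measureReal_le_one.trans (by linarith)
  have h1 : 0 < (1 - ρ) * N := mul_pos (by linarith) hN
  have h2 : 0 < (1 + ρ) * N := mul_pos (by linarith) hN
  have hnorm : ∀ t : EuclideanSpace ℝ (Fin 2),
      |‖∑ i, t i • (![a, b] i)‖ ^ 2 - N * ‖t‖ ^ 2| ≤ ρ * N * ‖t‖ ^ 2 := by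
    intro t
    rw [EuclideanSpace.real_norm_sq_eq t, Fin.sum_univ_two, Fin.sum_univ_two]
    simp only [Matrix.cons_val_zero, Matrix.cons_val_one]
    rw [norm_add_sq_real, norm_smul, norm_smul, mul_pow, mul_pow, ha, hb, Real.norm_eq_abs,
      Real.norm_eq_abs, sq_abs, sq_abs, real_inner_smul_left, real_inner_smul_right]
    have e : t 0 ^ 2 * N + 2 * (t 0 * (t 1 * ⟪a, b⟫)) + t 1 ^ 2 * N - N * (t 0 ^ 2 + t 1 ^ 2) =
      2 * (t 0 * t 1) * ⟪a, b⟫ := by ring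
    rw [e, abs_mul]
    have h3 : |2 * (t 0 * t 1)| ≤ t 0 ^ 2 + t 1 ^ 2 := by
      rw [abs_le]
      constructor <;> nlinarith [sq_nonneg (t 0 + t 1), sq_nonneg (t 0 - t 1)]
    calc _ ≤ (t 0 ^ 2 + t 1 ^ 2) * (ρ * N) := by gcongr
      _ = _ := by ring
  have hmain := stdGaussian_signs_le ![a, b] (Real.sqrt_pos.mpr h1) (Real.sqrt_pos.mpr h2)
    (fun t => by
      refine abs_le_of_sq_le_sq' ?_ (norm_nonneg _) |>.2
      rw [mul_pow, Real.sq_sqrt h1.le]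
      have := (abs_le.mp (hnorm t)).1
      linarith)
    (fun t => by
      refine abs_le_of_sq_le_sq' ?_ (by positivity) |>.2
      rw [mul_pow, Real.sq_sqrt h2.le]
      have := (abs_le.mp (hnorm t)).2
      linarith)
  have hsub : {x | halfspace (a, 0) x = halfspace (b, 0) x} ⊆
      {x | ∀ i, (0 ≤ ⟪![a, b] i, x⟫ ↔ (fun _ => true : Fin 2 → Bool) i = true)} ∪
      {x | ∀ i, (0 ≤ ⟪![a, b] i, x⟫ ↔ (fun _ => false : Fin 2 → Bool) i = true)} := by
    intro x hx
    have hx' : (0 ≤ ⟪a, x⟫) ↔ (0 ≤ ⟪b, x⟫) := by simpa [halfspace] using hx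
    simp only [Set.mem_union, Set.mem_ofPred_eq, Fin.forall_fin_two, Matrix.cons_val_zero,
      Matrix.cons_val_one]
    by_cases h0 : 0 ≤ ⟪a, x⟫
    · left; simp [h0, hx'.mp h0]
    · right
      have h0' := hx'.not.mp h0
      simp [h0, h0']
  have hratio : (√((1 + ρ) * N) / √((1 - ρ) * N)) ^ 2 ≤ (1 + 2 * ρ) ^ 2 := by
    gcongr
    exact sqrt_ratio_le hρ h hN
  have e1 := hmain fun _ => true
  have e2 := hmain fun _ => false
  rw [Fintype.card_fin] at e1 e2
  refine (measureReal_mono hsub).trans ((measureReal_union_le _ _).trans ((add_le_add e1 e2).trans ?_))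
  change (√((1 + ρ) * N) / √((1 - ρ) * N)) ^ 2 / 2 ^ 2 +
    (√((1 + ρ) * N) / √((1 - ρ) * N)) ^ 2 / 2 ^ 2 ≤ _
  have := mul_nonneg hρ (sub_nonneg.mpr h)
  linarith

/-- A vector of signs. -/
noncomputable def signVec {n : ℕ} (σ : Fin n → Bool) : EuclideanSpace ℝ (Fin n) :=
  WithLp.toLp 2 fun i => if σ i then 1 else -1

theorem norm_sq_signVec {n : ℕ} (σ : Fin n → Bool) : ‖signVec σ‖ ^ 2 = n := by
  rw [EuclideanSpace.real_norm_sq_eq]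
  have : ∀ i, (signVec σ) i ^ 2 = 1 := fun i => by
    simp only [signVec]; split_ifs <;> norm_num
  simp [this]

/-- The inner product is a sum of `n` independent signs, each with moment generating function `cosh
t ≤ exp (t²/2)`. -/
theorem sum_exp_inner_signVec_le {n : ℕ} (σ : Fin n → Bool) (t : ℝ) :
    ∑ τ : Fin n → Bool, Real.exp (t * ⟪signVec σ, signVec τ⟫) ≤ 2 ^ n * Real.exp (n * (t ^ 2 / 2)) := by
  let s : Bool → ℝ := fun b => if b then 1 else -1
  have h1 : ∀ τ : Fin n → Bool, Real.exp (t * ⟪signVec σ, signVec τ⟫) =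
      ∏ i, Real.exp (t * (s (σ i) * s (τ i))) := by
    intro τ
    rw [inner_eq_sum, Finset.mul_sum, Real.exp_sum]
    rfl
  have h2 : ∀ i, ∑ b, Real.exp (t * (s (σ i) * s b)) = 2 * Real.cosh t := by
    intro i
    rw [Fintype.sum_bool, Real.cosh_eq]
    cases σ i <;> simp [s] <;> ring
  calc _ = ∑ τ : Fin n → Bool, ∏ i, Real.exp (t * (s (σ i) * s (τ i))) :=
        Finset.sum_congr rfl fun τ _ => h1 τ
    _ = ∏ i : Fin n, ∑ b, Real.exp (t * (s (σ i) * s b)) := by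
        rw [Finset.prod_univ_sum, Fintype.piFinset_univ]
    _ = 2 ^ n * Real.cosh t ^ n := by
        simp only [h2, Finset.prod_const, Finset.card_univ, Fintype.card_fin, mul_pow]
    _ ≤ 2 ^ n * Real.exp (t ^ 2 / 2) ^ n := by
        gcongr
        exact Real.cosh_le_exp_half_sq t
    _ = _ := by rw [← Real.exp_nat_mul]

/-- A random halfspace whose normal vector is a uniform vector of signs. -/
noncomputable def signHalfspace (n : ℕ) : RandomFunction (EuclideanSpace ℝ (Fin n)) where
  Ω := Fin n → Bool
  μ := Measure.pi fun _ => coin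
  eval σ := halfspace (signVec σ, 0)
  measurable_eval := measurable_from_prod_countable_right fun σ => measurable_halfspace (signVec σ, 0)

theorem signHalfspace_isOver (n : ℕ) : (signHalfspace n).IsOver (LTF n) :=
  ae_of_all _ fun σ => halfspace_mem_LTF (signVec σ, 0)

theorem signHalfspace_labelProb {n q : ℕ} (S : Fin q → EuclideanSpace ℝ (Fin n)) (y : Fin q → Bool) :
    (signHalfspace n).labelProb S y =
      ∑ σ : Fin n → Bool, (2⁻¹ : ℝ) ^ n * if (fun i => halfspace (signVec σ, 0) (S i)) = y then 1 else 0 := by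
  classical
  have h1 : ∀ σ : Fin n → Bool, (Measure.pi fun _ : Fin n => coin).real {σ} = (2⁻¹ : ℝ) ^ n := by
    intro σ
    rw [measureReal_def, Measure.pi_singleton]
    simp [coin_singleton]
  have h2 : {σ : Fin n → Bool | ∀ i, halfspace (signVec σ, 0) (S i) = y i} =
      (Finset.univ.filter fun σ : Fin n → Bool => (fun i => halfspace (signVec σ, 0) (S i)) = y : Set _) := by
    ext σ; simp [funext_iff]
  change (Measure.pi fun _ : Fin n => coin).real
    {σ : Fin n → Bool | ∀ i, halfspace (signVec σ, 0) (S i) = y i} = _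
  rw [h2, ← sum_measureReal_singleton, Finset.sum_filter]
  refine Finset.sum_congr rfl fun σ _ => ?_
  rw [h1, mul_ite, mul_one, mul_zero]

/-- The places where two sign halfspaces agree. -/
def agreeSet {n : ℕ} (z : (Fin n → Bool) × (Fin n → Bool)) : Set (EuclideanSpace ℝ (Fin n)) :=
  {x | halfspace (signVec z.1, 0) x = halfspace (signVec z.2, 0) x}

/-- The sum of squares is a collision probability: two independent draws label all of `S` alike. -/
theorem sum_sq_labelProb {n q : ℕ} (S : Fin q → EuclideanSpace ℝ (Fin n)) :
    ∑ y, (signHalfspace n).labelProb S y ^ 2 =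
      ∑ z : (Fin n → Bool) × (Fin n → Bool), ((2⁻¹ : ℝ) ^ n) ^ 2 *
        (Set.univ.pi fun _ : Fin q => agreeSet z).indicator (fun _ => 1) S := by
  classical
  simp only [signHalfspace_labelProb, sq (∑ _, _), Finset.sum_mul_sum]
  rw [Finset.sum_comm, Fintype.sum_prod_type]
  refine Finset.sum_congr rfl fun σ _ => ?_
  rw [Finset.sum_comm]
  refine Finset.sum_congr rfl fun τ _ => ?_
  have h1 : ∀ y : Fin q → Bool,
      ((2⁻¹ : ℝ) ^ n * if (fun i => halfspace (signVec σ, 0) (S i)) = y then 1 else 0) *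
      ((2⁻¹ : ℝ) ^ n * if (fun i => halfspace (signVec τ, 0) (S i)) = y then 1 else 0) =
      if (fun i => halfspace (signVec σ, 0) (S i)) = y then ((2⁻¹ : ℝ) ^ n) ^ 2 *
        (if (fun i => halfspace (signVec τ, 0) (S i)) = y then 1 else 0) else 0 := by
    intro y
    split_ifs <;> ring
  rw [Finset.sum_congr rfl fun y _ => h1 y, Finset.sum_ite_eq, if_pos (Finset.mem_univ _),
    Set.indicator_apply]
  congr 1
  refine if_congr ?_ rfl rfl
  rw [Set.mem_univ_pi, funext_iff]
  exact forall_congr' fun i => eq_comm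

theorem measurableSet_agreeSet {n : ℕ} (z : (Fin n → Bool) × (Fin n → Bool)) :
    MeasurableSet (agreeSet z) :=
  measurableSet_eq_fun (measurable_halfspace _) (measurable_halfspace _)

/-- For a fixed pair of halfspaces the sample points are independent, so agreement on all of `S` is
a `q`-th power. -/
theorem integral_sum_sq_labelProb (n q : ℕ) :
    Integrable (fun S => ∑ y, (signHalfspace n).labelProb S y ^ 2)
      (Measure.pi fun _ : Fin q => stdGaussian (EuclideanSpace ℝ (Fin n))) ∧
    ∫ S, ∑ y, (signHalfspace n).labelProb S y ^ 2
      ∂(Measure.pi fun _ : Fin q => stdGaussian (EuclideanSpace ℝ (Fin n))) =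
      ∑ z : (Fin n → Bool) × (Fin n → Bool), ((2⁻¹ : ℝ) ^ n) ^ 2 *
        (stdGaussian (EuclideanSpace ℝ (Fin n))).real (agreeSet z) ^ q := by
  have hms : ∀ z : (Fin n → Bool) × (Fin n → Bool),
      MeasurableSet (Set.univ.pi fun _ : Fin q => agreeSet z) :=
    fun z => MeasurableSet.univ_pi fun _ => measurableSet_agreeSet z
  have hint : ∀ z ∈ (Finset.univ : Finset ((Fin n → Bool) × (Fin n → Bool))),
      Integrable (fun S => ((2⁻¹ : ℝ) ^ n) ^ 2 *
        (Set.univ.pi fun _ : Fin q => agreeSet z).indicator (fun _ => 1) S)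
      (Measure.pi fun _ : Fin q => stdGaussian (EuclideanSpace ℝ (Fin n))) :=
    fun z _ => ((integrable_const _).indicator (hms z)).const_mul _
  simp only [sum_sq_labelProb]
  refine ⟨integrable_finsetSum _ hint, ?_⟩
  rw [integral_finsetSum _ hint]
  refine Finset.sum_congr rfl fun z _ => ?_
  rw [integral_const_mul, integral_indicator_const _ (hms z), smul_eq_mul, mul_one,
    measureReal_def, Measure.pi_pi, Finset.prod_const, Finset.card_univ, Fintype.card_fin,
    ENNReal.toReal_pow, measureReal_def]

/-- The chord bound from convexity. It makes the excess of the second moment over `1` linear in `s`,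
so that a small `s` gives a small excess. -/
theorem exp_mul_le {s x : ℝ} (hs0 : 0 ≤ s) (hs1 : s ≤ 1) : Real.exp (s * x) ≤ 1 + s * (Real.exp x - 1) := by
  have := convexOn_exp.2 (Set.mem_univ x) (Set.mem_univ 0) hs0 (sub_nonneg.mpr hs1) (by ring)
  simp only [smul_eq_mul, mul_zero, add_zero, Real.exp_zero, mul_one] at this
  linarith

/-- The second moment of the label probabilities of random sign halfspaces. -/
theorem integral_sum_sq_le {n q : ℕ} (hn : 0 < n) {s : ℝ} (hs1 : s ≤ 1) (hs : 6 * q ≤ s * √n) :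
    2 ^ q * ∫ S, ∑ y, (signHalfspace n).labelProb S y ^ 2
      ∂(Measure.pi fun _ : Fin q => stdGaussian (EuclideanSpace ℝ (Fin n))) ≤ 1 + 3 * s := by
  rw [(integral_sum_sq_labelProb n q).2, Finset.mul_sum]
  have hn0 : (0 : ℝ) < n := by exact_mod_cast hn
  have hsq : 0 < √(n : ℝ) := Real.sqrt_pos.mpr hn0
  have hs0 : 0 ≤ s := by
    by_contra hcon
    have : s * √n < 0 := mul_neg_of_neg_of_pos (not_le.mp hcon) hsq
    have : (0 : ℝ) ≤ 6 * q := by positivity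
    linarith
  -- At the natural scale of the inner product, each of the two exponential moments averages to at
  -- most `exp (1/2) ≤ 2`; together they give `1 + s(4 - 1)`.
  set t : ℝ := (√n)⁻¹ with ht
  have ht2 : n * (t ^ 2 / 2) = 1 / 2 := by
    rw [ht, inv_pow, Real.sq_sqrt hn0.le]; field_simp
  set c : ℝ := ((2⁻¹ : ℝ) ^ n) ^ 2 with hcdef
  have hc0 : 0 < c := by positivity
  have hc : c * (2 ^ n * 2 ^ n) = 1 := by
    rw [hcdef, sq, inv_pow]; field_simp
  have hexp : Real.exp (1 / 2) ≤ 2 := by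
    have h3 := Real.exp_one_lt_three
    have h4 : Real.exp (1 / 2) ^ 2 = Real.exp 1 := by
      rw [← Real.exp_nat_mul]; norm_num
    nlinarith [Real.exp_pos (1 / 2)]
  have hterm : ∀ z : (Fin n → Bool) × (Fin n → Bool),
      2 ^ q * (c * (stdGaussian (EuclideanSpace ℝ (Fin n))).real (agreeSet z) ^ q) ≤
      c * (1 - s) + c * s * (Real.exp (t * ⟪signVec z.1, signVec z.2⟫) +
        Real.exp (-t * ⟪signVec z.1, signVec z.2⟫)) := by
    intro z
    set I := ⟪signVec z.1, signVec z.2⟫ with hI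
    set ρ := |I| / n with hρ
    have hag : (stdGaussian (EuclideanSpace ℝ (Fin n))).real (agreeSet z) ≤ (1 + 6 * ρ) / 2 :=
      stdGaussian_agree_le hn0 (by positivity) (norm_sq_signVec _) (norm_sq_signVec _)
        (by rw [hρ, div_mul_cancel₀ _ hn0.ne'])
    have h1 : 2 ^ q * (stdGaussian (EuclideanSpace ℝ (Fin n))).real (agreeSet z) ^ q ≤
        Real.exp (s * (t * |I|)) := by
      calc _ = (2 * (stdGaussian (EuclideanSpace ℝ (Fin n))).real (agreeSet z)) ^ q := by rw [mul_pow]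
        _ ≤ Real.exp (6 * ρ) ^ q := by
            gcongr
            linarith [Real.add_one_le_exp (6 * ρ)]
        _ = Real.exp (6 * q * ρ) := by rw [← Real.exp_nat_mul]; congr 1; ring
        _ ≤ Real.exp (s * √n * ρ) := by gcongr
        _ = _ := by
            congr 1
            rw [hρ, ht]
            have : (n : ℝ) = √n * √n := (Real.mul_self_sqrt hn0.le).symm
            rw [mul_div_assoc', div_eq_iff hn0.ne']
            nth_rewrite 3 [this]
            field_simp
    have h2 : Real.exp (t * |I|) ≤ Real.exp (t * I) + Real.exp (-t * I) := by
      rcases abs_choice I with h | h <;> rw [h]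
      · linarith [Real.exp_pos (-t * I)]
      · rw [show t * -I = -t * I by ring]; linarith [Real.exp_pos (t * I)]
    have h3 := h1.trans (exp_mul_le hs0 hs1)
    have h4 := mul_le_mul_of_nonneg_left h2 hs0
    calc _ = c * (2 ^ q * (stdGaussian (EuclideanSpace ℝ (Fin n))).real (agreeSet z) ^ q) := by ring
      _ ≤ c * ((1 - s) + s * (Real.exp (t * I) + Real.exp (-t * I))) := by
          gcongr
          linarith
      _ = _ := by ring
  have hmgf : ∀ r : ℝ, n * (r ^ 2 / 2) = 1 / 2 →
      ∑ z : (Fin n → Bool) × (Fin n → Bool), Real.exp (r * ⟪signVec z.1, signVec z.2⟫) ≤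
        2 ^ n * 2 ^ n * 2 := by
    intro r hr
    rw [Fintype.sum_prod_type]
    calc _ ≤ ∑ _σ : Fin n → Bool, (2 ^ n * 2 : ℝ) := by
          refine Finset.sum_le_sum fun σ _ => (sum_exp_inner_signVec_le σ r).trans ?_
          rw [hr]
          gcongr
      _ = _ := by simp; ring
  refine (Finset.sum_le_sum fun z _ => hterm z).trans ?_
  rw [Finset.sum_add_distrib, Finset.sum_const, ← Finset.mul_sum, Finset.sum_add_distrib,
    nsmul_eq_mul, Finset.card_univ, Fintype.card_prod, Fintype.card_fun, Fintype.card_bool, Fintype.card_fin]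
  push_cast
  have h5 := add_le_add (hmgf t ht2) (hmgf (-t) (by rw [neg_sq, ht2]))
  have h6 := mul_le_mul_of_nonneg_left h5 (mul_nonneg hc0.le hs0)
  calc _ ≤ 2 ^ n * 2 ^ n * (c * (1 - s)) + c * s * (2 ^ n * 2 ^ n * 2 + 2 ^ n * 2 ^ n * 2) := by gcongr
    _ = (c * (2 ^ n * 2 ^ n)) * (1 + 3 * s) := by ring
    _ = _ := by rw [hc, one_mul]

/-- Variation distance from uniform is controlled by the second moment. -/
theorem sq_labelDist_le {X : Type*} [MeasurableSpace X] (π π' : RandomFunction X) {q : ℕ}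
    (S : Fin q → X) (h : ∀ y, π'.labelProb S y = (2⁻¹ : ℝ) ^ q) :
    4 * π.labelDist π' S ^ 2 ≤ 2 ^ q * ∑ y, π.labelProb S y ^ 2 - 1 := by
  have hq : (2 : ℝ) ^ q * 2⁻¹ ^ q = 1 := by rw [← mul_pow]; norm_num
  have hcs := sq_sum_le_card_mul_sum_sq (s := (Finset.univ : Finset (Fin q → Bool)))
    (f := fun y => |π.labelProb S y - (2⁻¹ : ℝ) ^ q|)
  have h1 : 4 * π.labelDist π' S ^ 2 = (∑ y, |π.labelProb S y - (2⁻¹ : ℝ) ^ q|) ^ 2 := by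
    simp only [RandomFunction.labelDist, h]; ring
  have hcard : ((Finset.univ : Finset (Fin q → Bool)).card : ℝ) = 2 ^ q := by simp
  rw [h1]
  refine hcs.trans (le_of_eq ?_)
  have h2 : ∀ y, |π.labelProb S y - (2⁻¹ : ℝ) ^ q| ^ 2 =
      π.labelProb S y ^ 2 - 2 * 2⁻¹ ^ q * π.labelProb S y + (2⁻¹ ^ q) ^ 2 := by
    intro y; rw [sq_abs]; ring
  simp only [h2]
  rw [Finset.sum_add_distrib, Finset.sum_sub_distrib, ← Finset.mul_sum, π.sum_labelProb_eq_one S,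
    Finset.sum_const, nsmul_eq_mul, hcard]
  linear_combination (2 ^ q * 2⁻¹ ^ q - 1 : ℝ) * hq

/-- The passive testing dimension of halfspaces is at least of order `√n`. -/
theorem le_passiveDim_LTF {n q : ℕ} (hn : 0 < n) (hq : 576 * (q : ℝ) ≤ √n) {ε δ : ℝ} (hε : 0 < ε)
    (hε' : ε < 1 / 2) (hδ : 0 < δ) :
    (q : ℕ∞) ≤ passiveDim (LTF n) (stdGaussian (EuclideanSpace ℝ (Fin n))) ε δ := by
  obtain ⟨cell, hc, hcell, hfar⟩ := exists_randomColoring_isFar hn hε hε' hδ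
    (κ₀ := 1 / (8 * (q ^ 2 + 1))) (by positivity)
  refine le_iSup₂_of_le q ⟨signHalfspace n, randomColoring cell hc,
    signHalfspace_isOver n, hfar, ?_⟩ le_rfl
  set Z : (Fin q → EuclideanSpace ℝ (Fin n)) → ℝ :=
    fun S => 2 ^ q * ∑ y, (signHalfspace n).labelProb S y ^ 2 - 1 with hZ
  have hZ0 : ∀ S, 0 ≤ Z S := by
    intro S
    have hcs := sq_sum_le_card_mul_sum_sq (s := (Finset.univ : Finset (Fin q → Bool)))
      (f := fun y => (signHalfspace n).labelProb S y)
    rw [(signHalfspace n).sum_labelProb_eq_one S] at hcs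
    have hcard : ((Finset.univ : Finset (Fin q → Bool)).card : ℝ) = 2 ^ q := by simp
    rw [hcard] at hcs
    simp only [hZ]
    linarith
  have hZi : Integrable Z (Measure.pi fun _ : Fin q => stdGaussian (EuclideanSpace ℝ (Fin n))) :=
    ((integral_sum_sq_labelProb n q).1.const_mul _).sub (integrable_const _)
  have hEZ : ∫ S, Z S ∂(Measure.pi fun _ : Fin q => stdGaussian (EuclideanSpace ℝ (Fin n))) ≤ 1 / 32 := by
    -- With `s = 1/96` the hypothesis reads `576 q ≤ √n` and the excess is at most `1/32`. Markov at
    -- level `1/4` leaves probability `1/8`, and `Z < 1/4` forces label distance below `1/4`.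
    have h1 := integral_sum_sq_le (n := n) (q := q) hn (s := 1 / 96) (by norm_num) (by linarith)
    simp only [hZ]
    rw [integral_sub ((integral_sum_sq_labelProb n q).1.const_mul _) (integrable_const _),
      integral_const_mul]
    simp only [integral_const, probReal_univ, one_smul]
    linarith
  have hM := mul_meas_ge_le_integral_of_nonneg (ae_of_all _ hZ0) hZi (1 / 4)
  have hM' : (Measure.pi fun _ : Fin q => stdGaussian (EuclideanSpace ℝ (Fin n))).real
      {S | 1 / 4 ≤ Z S} ≤ 1 / 8 := by linarith
  have hsub : {S : Fin q → EuclideanSpace ℝ (Fin n) |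
      1 / 4 < (signHalfspace n).labelDist (randomColoring cell hc) S} ⊆
      {S | ¬ Function.Injective fun i => cell (S i)} ∪ {S | 1 / 4 ≤ Z S} := by
    intro S hS
    by_contra hcon
    simp only [Set.mem_union, Set.mem_ofPred_eq, not_or, not_not, not_le] at hcon hS
    have h1 := sq_labelDist_le (signHalfspace n) (randomColoring cell hc) S
      (randomColoring_labelProb cell hc S hcon.1)
    have h2 := hcon.2
    simp only [hZ] at h2
    nlinarith
  have h3 := measure_not_injective_le (stdGaussian (EuclideanSpace ℝ (Fin n))) hc hcell q
  have h4 : ((q : ℝ≥0∞) ^ 2 * ENNReal.ofReal (1 / (8 * (q ^ 2 + 1)))) ≤ ENNReal.ofReal (1 / 8) := by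
    rw [← ENNReal.ofReal_natCast, ← ENNReal.ofReal_pow (by positivity), ← ENNReal.ofReal_mul (by positivity)]
    refine ENNReal.ofReal_le_ofReal ?_
    rw [mul_one_div, div_le_div_iff₀ (by positivity) (by norm_num)]
    nlinarith [sq_nonneg (q : ℝ)]
  have h5 := ENNReal.ofReal_le_ofReal hM'
  rw [ofReal_measureReal] at h5
  refine (measure_mono hsub).trans ((measure_union_le _ _).trans
    ((add_le_add (h3.trans h4) h5).trans ?_))
  rw [← ENNReal.ofReal_add (by norm_num) (by norm_num)]
  refine le_trans (ENNReal.ofReal_le_ofReal (q := 4⁻¹) (by norm_num)) ?_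
  rw [ENNReal.ofReal_inv_of_pos (by norm_num), ENNReal.ofReal_ofNat, one_div]

/-! ### Asymptotics and choice of constants -/

theorem tendsto_natCast_div_log : Tendsto (fun n : ℕ => (n : ℝ) / Real.log n) atTop atTop := by
  have h1 : Tendsto (fun x : ℝ => Real.log x / x) atTop (𝓝 0) :=
    Real.isLittleO_log_id_atTop.tendsto_div_nhds_zero
  have h2 : Tendsto (fun x : ℝ => Real.log x / x) atTop (𝓝[>] 0) := by
    refine tendsto_nhdsWithin_iff.mpr ⟨h1, ?_⟩
    filter_upwards [eventually_gt_atTop 1] with x hx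
    exact div_pos (Real.log_pos hx) (by linarith)
  have h3 := (tendsto_inv_nhdsGT_zero.comp h2).comp (tendsto_natCast_atTop_atTop (R := ℝ))
  refine h3.congr fun n => ?_
  simp

theorem ofReal_le_natCast_le {x : ℝ} {d : ℕ∞} (h : (⌈x⌉₊ : ℕ∞) ≤ d) :
    ENNReal.ofReal x ≤ (d : ℝ≥0∞) := by
  calc ENNReal.ofReal x ≤ ENNReal.ofReal (⌈x⌉₊ : ℝ) := ENNReal.ofReal_le_ofReal (Nat.le_ceil x)
    _ = ((⌈x⌉₊ : ℕ∞) : ℝ≥0∞) := by simp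
    _ ≤ (d : ℝ≥0∞) := ENat.toENNReal_le.mpr h

theorem ceil_le_two_mul {x : ℝ} (hx : 1 ≤ x) : (⌈x⌉₊ : ℝ) ≤ 2 * x := by
  linarith [Nat.ceil_lt_add_one (zero_le_one.trans hx)]

theorem passive_lower_bound : ∃ c : ℝ, 0 < c ∧ ∀ ε : ℝ, 0 < ε → ε < 1 / 2 →
    ∃ δ : ℕ → ℝ, Tendsto δ atTop (𝓝 0) ∧ ∀ᶠ n : ℕ in atTop,
      ENNReal.ofReal (c * Real.sqrt (n / Real.log n)) ≤
        (passiveDim (LTF n) (stdGaussian (EuclideanSpace ℝ (Fin n))) ε (δ n) : ℝ≥0∞) := by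
  -- Once its argument is at least `1` the ceiling at most doubles it, and `576 · 2 / 2000 < 1`.
  refine ⟨1 / 2000, by norm_num, fun ε hε hε' => ⟨fun n => 1 / ((n : ℝ) + 1),
    tendsto_one_div_add_atTop_nhds_zero_nat, ?_⟩⟩
  filter_upwards [eventually_gt_atTop 0, tendsto_natCast_div_log.eventually_ge_atTop (2000 ^ 2),
    (Real.tendsto_log_atTop.comp tendsto_natCast_atTop_atTop).eventually_ge_atTop 1] with n hn hx hlog
  have hlog' : 1 ≤ Real.log n := hlog
  have hn0 : (0 : ℝ) < n := by exact_mod_cast hn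
  have h1 : 2000 ≤ √(n / Real.log n) := Real.le_sqrt_of_sq_le hx
  have h2 : √(n / Real.log n) ≤ √n := Real.sqrt_le_sqrt (div_le_self hn0.le hlog')
  refine ofReal_le_natCast_le (le_passiveDim_LTF hn ?_ hε hε' (by positivity))
  have h3 := ceil_le_two_mul (x := 1 / 2000 * √(n / Real.log n)) (by linarith)
  linarith

/-- The union bound counts at most `exp ((k+1) q log n)` events, while the tail exponent `n / (2048
q²)` is at least `2(k+2) q log n`. The remainder `(k+3) q log n ≥ 9` beats the constants. -/
theorem active_condition {n u k q : ℕ} (hn : 3 ≤ n) (hlog : 3 ≤ Real.log n) (hu : u ≤ n ^ k) (hq : 0 < q)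
    (hq3 : (q : ℝ) ^ 3 * (4096 * (k + 2)) ≤ n / Real.log n) :
    (u * (4 * q + 1) : ℝ) ^ q * (2 * Real.exp (-(n * (1 / (16 * q)) ^ 2 / 8))) ≤ 1 / 8 := by
  have hn0 : (0 : ℝ) < n := by positivity
  have hq1 : (1 : ℝ) ≤ q := by exact_mod_cast hq
  have hk0 : (0 : ℝ) ≤ k := by positivity
  have hlog0 : 0 < Real.log n := by linarith
  have hnq : (q : ℝ) ^ 3 * (4096 * (k + 2)) * Real.log n ≤ n := by
    rwa [le_div_iff₀ hlog0] at hq3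
  have hqn : (4 * q + 1 : ℝ) ≤ n := by
    have h1 : (q : ℝ) ≤ q ^ 3 := le_self_pow₀ hq1 (by norm_num)
    have h2 : (q : ℝ) ^ 3 * 8192 ≤ q ^ 3 * (4096 * (k + 2)) := by gcongr; linarith
    have h3 : (q : ℝ) ^ 3 * (4096 * (k + 2)) * 1 ≤ q ^ 3 * (4096 * (k + 2)) * Real.log n := by
      gcongr; linarith
    linarith
  have hun : (u : ℝ) ≤ n ^ k := by exact_mod_cast hu
  have h1 : (u * (4 * q + 1) : ℝ) ^ q ≤ Real.exp ((k + 1) * q * Real.log n) := by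
    calc (u * (4 * q + 1) : ℝ) ^ q ≤ ((n : ℝ) ^ k * n) ^ q := by gcongr
      _ = (n : ℝ) ^ ((k + 1) * q) := by rw [← pow_succ, ← pow_mul]
      _ = Real.exp ((k + 1) * q * Real.log n) := by
          rw [← Real.exp_log (pow_pos hn0 _), Real.log_pow]; push_cast; rfl
  have h2 : 2 * (k + 2) * q * Real.log n ≤ n * (1 / (16 * q)) ^ 2 / 8 := by
    have : n * (1 / (16 * q : ℝ)) ^ 2 / 8 = n / (2048 * q ^ 2) := by field_simp; norm_num
    rw [this, le_div_iff₀ (by positivity)]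
    calc _ = (q : ℝ) ^ 3 * (4096 * (k + 2)) * Real.log n := by ring
      _ ≤ n := hnq
  have h3 : 9 ≤ (k + 3) * q * Real.log n := by
    have h4 : (3 : ℝ) ≤ (k + 3) * q := by nlinarith
    nlinarith
  have h4 : Real.exp (-9) ≤ 1 / 16 := by
    rw [Real.exp_neg, inv_eq_one_div]
    refine one_div_le_one_div_of_le (by norm_num) ?_
    have h5 := Real.quadratic_le_exp_of_nonneg (x := 9) (by norm_num)
    linarith
  calc _ ≤ Real.exp ((k + 1) * q * Real.log n) * (2 * Real.exp (-(2 * (k + 2) * q * Real.log n))) := by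
        gcongr
    _ = 2 * Real.exp (-((k + 3) * q * Real.log n)) := by
        rw [mul_left_comm, ← Real.exp_add]; congr 2; ring
    _ ≤ 2 * Real.exp (-9) := by gcongr
    _ ≤ 1 / 8 := by linarith

theorem active_lower_bound (k : ℕ) : ∃ c : ℝ, 0 < c ∧ ∀ ε : ℝ, 0 < ε → ε < 1 / 2 →
    ∃ δ : ℕ → ℝ, Tendsto δ atTop (𝓝 0) ∧ ∀ᶠ n : ℕ in atTop, ∀ u : ℕ, u ≤ n ^ k →
      ENNReal.ofReal (c * ((n : ℝ) / Real.log n) ^ (1 / 3 : ℝ)) ≤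
        (activeDim (LTF n) (stdGaussian (EuclideanSpace ℝ (Fin n))) u ε (δ n) : ℝ≥0∞) := by
  have hc : (0 : ℝ) < 1 / (32 * (k + 2)) := by positivity
  refine ⟨1 / (32 * (k + 2)), hc, fun ε hε hε' => ⟨fun n => 1 / ((n : ℝ) + 1),
    tendsto_one_div_add_atTop_nhds_zero_nat, ?_⟩⟩
  filter_upwards [eventually_ge_atTop 3,
    tendsto_natCast_div_log.eventually_ge_atTop ((32 * (k + 2)) ^ 3),
    (Real.tendsto_log_atTop.comp tendsto_natCast_atTop_atTop).eventually_ge_atTop 3] with n hn hx hlog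
  intro u hu
  set y : ℝ := (n : ℝ) / Real.log n with hy
  have hy0 : 0 ≤ y := le_trans (by positivity) hx
  set x : ℝ := y ^ (1 / 3 : ℝ) with hxdef
  have hx3 : x ^ 3 = y := by
    rw [hxdef, ← Real.rpow_natCast, ← Real.rpow_mul hy0]; norm_num
  have hx0 : 0 ≤ x := Real.rpow_nonneg hy0 _
  have hxge : 32 * (k + 2 : ℝ) ≤ x := by
    rw [← hx3] at hx
    exact le_of_pow_le_pow_left₀ (by norm_num) hx0 hx
  have hcx : 1 ≤ 1 / (32 * (k + 2)) * x := by
    rw [one_div, inv_mul_eq_div, le_div_iff₀ (by positivity), one_mul]; exact hxge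
  have hceil := ceil_le_two_mul hcx
  have hq : 0 < ⌈1 / (32 * (k + 2)) * x⌉₊ := Nat.ceil_pos.mpr (by linarith)
  refine ofReal_le_natCast_le (le_activeDim_LTF (by omega) hq hε hε' (by positivity) ?_)
  refine active_condition hn hlog hu hq ?_
  rw [← hy, ← hx3]
  -- After doubling by the ceiling, `q ≤ x / (16(k+2))`; since `16³ = 4096`, a factor `(k+2)⁻²` is
  -- to spare.
  calc _ ≤ (2 * (1 / (32 * (k + 2)) * x)) ^ 3 * (4096 * (k + 2)) := by gcongr
    _ = x ^ 3 * (1 / (k + 2)) ^ 2 := by field_simp; ring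
    _ ≤ x ^ 3 * 1 := by
        gcongr
        refine pow_le_one₀ (by positivity) ?_
        rw [div_le_one (by positivity)]
        linarith [(Nat.cast_nonneg k : (0 : ℝ) ≤ k)]
    _ = x ^ 3 := mul_one _

end PropertyTesting

theorem mainTheorem3 :
    (∃ c : ℝ, 0 < c ∧ ∀ ε : ℝ, 0 < ε → ε < 1 / 2 →
      ∃ δ : ℕ → ℝ, Tendsto δ atTop (𝓝 0) ∧ ∀ᶠ n : ℕ in atTop,
        ENNReal.ofReal (c * Real.sqrt (n / Real.log n)) ≤
          (PropertyTesting.passiveDim (PropertyTesting.LTF n)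
            (stdGaussian (EuclideanSpace ℝ (Fin n))) ε (δ n) : ℝ≥0∞)) ∧
    (∀ k : ℕ, ∃ c : ℝ, 0 < c ∧ ∀ ε : ℝ, 0 < ε → ε < 1 / 2 →
      ∃ δ : ℕ → ℝ, Tendsto δ atTop (𝓝 0) ∧ ∀ᶠ n : ℕ in atTop, ∀ u : ℕ, u ≤ n ^ k →
        ENNReal.ofReal (c * ((n : ℝ) / Real.log n) ^ (1 / 3 : ℝ)) ≤
          (PropertyTesting.activeDim (PropertyTesting.LTF n)
            (stdGaussian (EuclideanSpace ℝ (Fin n))) u ε (δ n) : ℝ≥0∞)) :=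
  ⟨PropertyTesting.passive_lower_bound, PropertyTesting.active_lower_bound⟩
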